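/- A partition is identified with its Young diagram, a finite set of squares $(i,j)$ (row $i\ge 0$, column $j\ge 0$). A skew semistandard tableau of shape $\lambda/\mu$ (a pair of partitions with $\mu\subseteq\lambda$) is a filling of the squares of $\lambda$ not in $\mu$ with entries in $\mathbb{N}=\{0,1,2,\dots\}$ that weakly increase from left to right along rows and strictly increase from top to bottom down columns. It is a semistandard Young tableau if $\mu=0$ is the empty partition, and a Littlewood–Richardson tableau if, reading its entries row by row from top to bottom and each row from right to left, every initial part of the resulting word contains at least as many letters $i$ as letters $i+1$, for every $i\in\mathbb{N}$. An inward jeu de taquin slide applies to a tableau of shape $\lambda/\mu$ and a corner $c$ of $\mu$: starting with $c$ as empty square, one repeatedly moves into the empty square the smaller of the entries directly to its right and directly below it (the one below in case of a tie; the only one present if there is just one), until the empty square $d$ has no square of $\lambda$ directly to its right or below; the result has shape $(\lambda\setminus\{d\})/(\mu\setminus\{c\})$. For a word $w'=u\,(i+1)\,v$ in the alphabet $\mathbb{N}$ such that every suffix of $u$ has at least as many letters $i+1$ as letters $i$, and every prefix of $v$ has at least as many letters $i$ as letters $i+1$, one sets $e_i(w')=u\,i\,v$; for a given $i$, $e_i(w')$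 is undefined if $w'$ has no such decomposition. A valid reading order on a skew diagram is a total order on its squares in which $(i,j)$ precedes or equals $(i',j')$ whenever $i\le i'$ and $j\ge j'$. The raising operation $e_i$ (for $i\in\mathbb{N}$) replaces a skew semistandard tableau $T$ by the skew semistandard tableau of the same shape whose reading word, for some valid reading order, is obtained by applying $e_i$ to the reading word of $T$ for that order (the choice of the order is known to be immaterial). **Statement.** On the set of all skew semistandard tableaux, the two rewrite systems defined by inward jeu de taquin slides, respectively by the raising operations $e_i$ ($i\in\mathbb{N}$), are both confluent: whenever $U$ and $V$ can both be reached from $T$ by finitely many (possibly zero) steps, there is a tableau reachable from both $U$ and $V$. The tableaux to which no inward slide applies are exactly the semistandard Young tableaux, and the tableaux to which no raising operation applies are exactly the Littlewood–Richardson tableaux. Every skew semistandard tableau $T$ has exactly one normal form for each of the two systems (a tableau reachable from $T$ to which no further step applies). Moreover the two normal forms of $T$ uniquely determine $T$: if $T_1$ and $T_2$ have the same normal form for inward slides and the same normal form for raising operations, then $T_1=T_2$. -/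

import Mathlib

/-! ### Rewrite systems -/

/-- A rewrite system (a relation `r a b`, "`a` rewrites to `b` in one step") is confluent if any two
objects reachable from a common one have a common descendant. -/
def Confluent {α : Type*} (r : α → α → Prop) : Prop :=
  ∀ a b c : α, Relation.ReflTransGen r a b → Relation.ReflTransGen r a c →
    ∃ d : α, Relation.ReflTransGen r b d ∧ Relation.ReflTransGen r c d

/-- An object to which no rewrite rule applies. -/
def IsNormal {α : Type*} (r : α → α → Prop) (a : α) : Prop :=
  ∀ b : α, ¬ r a b

/-- `b` is a normal form of `a`: it is reachable from `a` and no rule applies to it. -/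
def IsNormalFormOf {α : Type*} (r : α → α → Prop) (b a : α) : Prop :=
  Relation.ReflTransGen r a b ∧ IsNormal r b

/-! ### Skew semistandard tableaux -/

/-- A skew semistandard tableau of shape `outer / inner`, with entries in `ℕ`.
The square `(i, j)` lies in row `i` and column `j`, both counted from `0`.
As for Mathlib's `SemistandardYoungTableau`, entries outside the diagram are required to be zero, so
that equality of tableaux means equality of the shapes and of the entries in the diagram. -/
@[ext]
structure SkewSSYT where
  outer : YoungDiagram
  inner : YoungDiagram
  inner_le_outer : inner ≤ outer
  entry : ℕ → ℕ → ℕ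
  row_weak : ∀ i j₁ j₂ : ℕ, j₁ < j₂ → (i, j₁) ∉ inner → (i, j₂) ∈ outer →
    entry i j₁ ≤ entry i j₂
  col_strict : ∀ i₁ i₂ j : ℕ, i₁ < i₂ → (i₁, j) ∉ inner → (i₂, j) ∈ outer →
    entry i₁ j < entry i₂ j
  entry_eq_zero : ∀ i j : ℕ, ¬ ((i, j) ∈ outer ∧ (i, j) ∉ inner) → entry i j = 0

namespace SkewSSYT

/-- The squares of the skew diagram of `T`. -/
def cells (T : SkewSSYT) : Finset (ℕ × ℕ) :=
  T.outer.cells \ T.inner.cells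

/-- `T` is a semistandard Young tableau, i.e. a tableau of partition shape `outer / 0`. -/
def IsYoung (T : SkewSSYT) : Prop :=
  T.inner = ⊥

/-! ### Inward jeu de taquin slides -/

/-- Move the entry of the square `src` into the (empty) square `dst`, leaving `src` empty. -/
def moveEntry (f : ℕ → ℕ → ℕ) (src dst : ℕ × ℕ) : ℕ → ℕ → ℕ := fun i j =>
  if (i, j) = dst then f src.1 src.2 else if (i, j) = src then 0 else f i j

/-- One elementary move of an inward slide inside the diagram `outer`, on tableaux with an empty
square. The smaller of the entries right below and right of the empty square is moved into it; if
both are equal, it is the one below. -/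
inductive SlideMove (outer : YoungDiagram) :
    (ℕ × ℕ) × (ℕ → ℕ → ℕ) → (ℕ × ℕ) × (ℕ → ℕ → ℕ) → Prop
  | up (i j : ℕ) (f : ℕ → ℕ → ℕ) (below : (i + 1, j) ∈ outer)
      (le : (i, j + 1) ∈ outer → f (i + 1) j ≤ f i (j + 1)) :
      SlideMove outer ((i, j), f) ((i + 1, j), moveEntry f (i + 1, j) (i, j))
  | left (i j : ℕ) (f : ℕ → ℕ → ℕ) (right : (i, j + 1) ∈ outer)
      (lt : (i + 1, j) ∈ outer → f i (j + 1) < f (i + 1) j) :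
      SlideMove outer ((i, j), f) ((i, j + 1), moveEntry f (i, j + 1) (i, j))

/-- `T'` is obtained from `T` by an inward jeu de taquin slide into some corner `c` of the inner
shape of `T`: the empty square moves from `c` until it reaches a square `d` that has no square of
the outer shape below it or to its right. Then `c` is removed from the inner shape and `d` from the
outer shape. (That `c` and `d` are corners is implied, as the shapes of `T'` are Young diagrams.) -/
def InwardSlide (T T' : SkewSSYT) : Prop :=
  ∃ c ∈ T.inner, ∃ d ∈ T.outer,
    T'.inner.cells = T.inner.cells.erase c ∧
    T'.outer.cells = T.outer.cells.erase d ∧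
    (d.1 + 1, d.2) ∉ T.outer ∧ (d.1, d.2 + 1) ∉ T.outer ∧
    Relation.ReflTransGen (SlideMove T.outer) (c, T.entry) (d, T'.entry)

end SkewSSYT

/-! ### Raising operations on words -/

/-- Every prefix of `w` contains at least as many letters `i` as letters `i + 1`. -/
def DominantFor (i : ℕ) (w : List ℕ) : Prop :=
  ∀ u : List ℕ, u <+: w → u.count (i + 1) ≤ u.count i

/-- Every suffix of `w` contains at least as many letters `i + 1` as letters `i`. -/
def AntidominantFor (i : ℕ) (w : List ℕ) : Prop :=
  ∀ u : List ℕ, u <:+ w → u.count i ≤ u.count (i + 1)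

/-- `w = e_i(w')`: one has `w' = u (i+1) v` and `w = u i v` with `u` anti-dominant for `i` and `v`
dominant for `i`. -/
def RaisesWord (i : ℕ) (w' w : List ℕ) : Prop :=
  ∃ u v : List ℕ, w' = u ++ (i + 1) :: v ∧ w = u ++ i :: v ∧
    AntidominantFor i u ∧ DominantFor i v

namespace SkewSSYT

/-! ### Raising operations on tableaux -/

/-- A valid reading order for the diagram of `T`, given by the list of its squares in increasing
order: a total order in which `(i, j)` precedes `(i', j')` whenever these squares are distinct,
`i ≤ i'` and `j ≥ j'`. -/
def IsReadingOrder (T : SkewSSYT) (s : List (ℕ × ℕ)) : Prop :=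
  s.Nodup ∧ (∀ c : ℕ × ℕ, c ∈ s ↔ c ∈ T.cells) ∧
    s.Pairwise fun a b => ¬ (b.1 ≤ a.1 ∧ a.2 ≤ b.2)

/-- The word formed by the entries of `T` in the squares of the list `s`. -/
def readWord (T : SkewSSYT) (s : List (ℕ × ℕ)) : List ℕ :=
  s.map fun c => T.entry c.1 c.2

/-- `U = e_i(T)`: the tableau `U` has the same shape as `T`, and its reading word is obtained by
applying `e_i` to the reading word of `T`, for some valid reading order. -/
def Raises (i : ℕ) (T U : SkewSSYT) : Prop :=
  U.outer = T.outer ∧ U.inner = T.inner ∧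
    ∃ s : List (ℕ × ℕ), T.IsReadingOrder s ∧ RaisesWord i (T.readWord s) (U.readWord s)

/-- `U` is obtained from `T` by some raising operation `e_i`. -/
def RaisingStep (T U : SkewSSYT) : Prop :=
  ∃ i : ℕ, Raises i T U

/-! ### Littlewood-Richardson tableaux -/

/-- The entries of `T`, read by rows from top to bottom, each row from right to left. -/
def rowWord (T : SkewSSYT) : List ℕ :=
  (List.range (T.outer.colLen 0)).flatMap fun i =>
    (List.range' (T.inner.rowLen i) (T.outer.rowLen i - T.inner.rowLen i)).reverse.map (T.entry i)

/-- `T` is a Littlewood-Richardson tableau: `rowWord T` is a lattice permutation, i.e. the weight of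
each of its prefixes is a partition. -/
def IsLittlewoodRichardson (T : SkewSSYT) : Prop :=
  ∀ u : List ℕ, u <+: T.rowWord → ∀ i : ℕ, u.count (i + 1) ≤ u.count i

end SkewSSYT

/-! A skew tableau is the same thing as a chain of partitions `g 0 ⊆ g 1 ⊆ ...`, where `g k`
consists of the inner shape and the squares with entry less than `k`. Semistandardness says that
successive partitions interlace (`isPattern_pat`, `exists_pat_eq`). Both rewrite systems become
simple on such patterns. An inward slide removes one corner from every partition of the chain, the
row at level `k + 1` being determined by the row at level `k` (`inwardSlide_iff`). The operation
`e_i` adds one square to the single partition `g (i + 1)`, in the first row where the statistic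
`height g i` attains its minimum, provided that this minimum is negative (`raises_iff`). The
Littlewood–Richardson condition says that no height is negative.

The heart of the matter is that slides commute with raising operations (`RaisesPattern.slide`).
Moreover each labelled step is injective: `e_i` can be undone, and a slide can be undone once the
row it goes into and the original outer shape are known. Finally, a Littlewood–Richardson tableau of
partition shape has all entries of row `r` equal to `r`, so it is determined by its shape, and
equally by its weight.

Uniqueness of normal forms follows. Given slides from `T` to Young tableaux `P₁`, `P₂` and raisings
from `T` to a Littlewood–Richardson tableau `L`, commutation gives tableaux `Q₁`, `Q₂` reached from
`P₁`, `P₂` by the same raisings, and from `L` by slides. Both are Young and Littlewood–Richardson,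
with weights equal to that of `L`, so they coincide, and undoing the raisings gives `P₁ = P₂`. The
argument for raising normal forms is symmetric, using the shape instead of the weight. Completing a
square of the same kind shows that `P` and `L` determine `T`. Confluence follows from termination
together with uniqueness of normal forms. -/

/-! ### Interlacing patterns -/

/-- A chain of partitions (`g k r` is the length of row `r` of the `k`-th one) in which successive
partitions differ by horizontal strips, and which is eventually constant. -/
structure IsPattern (g : ℕ → ℕ → ℕ) : Prop where
  mono : ∀ k r, g k r ≤ g (k + 1) r
  interlace : ∀ k r, g (k + 1) (r + 1) ≤ g k r
  bounded : ∃ N, (∀ k, N ≤ k → g k = g N) ∧ ∀ r, N ≤ r → g N r = 0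

namespace IsPattern

variable {g : ℕ → ℕ → ℕ}

theorem mono_le (hg : IsPattern g) {k l : ℕ} (h : k ≤ l) (r : ℕ) : g k r ≤ g l r :=
  monotone_nat_of_le_succ (f := fun k => g k r) (fun k => hg.mono k r) h

theorem antitone (hg : IsPattern g) (k : ℕ) : Antitone (g k) :=
  antitone_nat_of_succ_le fun r => (hg.mono k (r + 1)).trans (hg.interlace k r)

theorem le_of_bound {N : ℕ} (hg : IsPattern g) (hN : ∀ k, N ≤ k → g k = g N) (k r : ℕ) :
    g k r ≤ g N r := by
  rcases le_total k N with h | h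
  · exact hg.mono_le h r
  · rw [hN k h]

end IsPattern

/-! ### Slides on interlacing patterns -/

/-- The rows of the squares that are successively removed from the partitions of a pattern
when a square is removed from row `r` of its first partition. -/
def slideRow (g : ℕ → ℕ → ℕ) (r : ℕ) : ℕ → ℕ
  | 0 => r
  | k + 1 => if g (k + 1) (slideRow g r k + 1) = g k (slideRow g r k) then slideRow g r k + 1
      else slideRow g r k

/-- The pattern obtained by removing a square from row `r` of the first partition, and propagating
the change along the chain. -/
def slidePattern (g : ℕ → ℕ → ℕ) (r : ℕ) : ℕ → ℕ → ℕ := fun k s =>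
  if s = slideRow g r k then g k s - 1 else g k s

theorem slideRow_succ_cases (g : ℕ → ℕ → ℕ) (r k : ℕ) :
    (g (k + 1) (slideRow g r k + 1) = g k (slideRow g r k) ∧
      slideRow g r (k + 1) = slideRow g r k + 1) ∨
    (g (k + 1) (slideRow g r k + 1) ≠ g k (slideRow g r k) ∧
      slideRow g r (k + 1) = slideRow g r k) := by
  by_cases h : g (k + 1) (slideRow g r k + 1) = g k (slideRow g r k)
  · exact Or.inl ⟨h, by simp [slideRow, h]⟩
  · exact Or.inr ⟨h, by simp [slideRow, h]⟩

theorem slideRow_mono (g : ℕ → ℕ → ℕ) (r : ℕ) : Monotone (slideRow g r) :=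
  monotone_nat_of_le_succ fun k => by
    rcases slideRow_succ_cases g r k with h | h <;> omega

/-- Interlacing carries the corner condition upwards. If the row `p` moves down, then `g (k+1) (p+2)
≤ g k (p+1) < g k p = g (k+1) (p+1)`; if it stays, then `g (k+1) (p+1) < g k p ≤ g (k+1) p`. -/
theorem slideRow_corner {g : ℕ → ℕ → ℕ} (hg : IsPattern g) {r : ℕ} (hr : g 0 (r + 1) < g 0 r)
    (k : ℕ) : g k (slideRow g r k + 1) < g k (slideRow g r k) := by
  induction k with
  | zero => exact hr
  | succ k ih =>
    have h1 := hg.interlace k (slideRow g r k)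
    have h2 := hg.interlace k (slideRow g r k + 1)
    have h3 := hg.mono k (slideRow g r k)
    rcases slideRow_succ_cases g r k with ⟨h, e⟩ | ⟨h, e⟩ <;> rw [e] <;> omega

/-- Between two equal partitions, moving down would need two consecutive rows of equal length, which
the corner condition forbids. -/
theorem slideRow_eventually {g : ℕ → ℕ → ℕ} (hg : IsPattern g) {r : ℕ} (hr : g 0 (r + 1) < g 0 r)
    {N : ℕ} (hN : ∀ k, N ≤ k → g k = g N) (k : ℕ) (hk : N ≤ k) :
    slideRow g r k = slideRow g r N := by
  induction k, hk using Nat.le_induction with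
  | base => rfl
  | succ k hk ih =>
    have h0 := slideRow_corner hg hr k
    rcases slideRow_succ_cases g r k with ⟨h, e⟩ | ⟨h, e⟩
    · rw [hN (k + 1) (by omega)] at h
      rw [hN k hk] at h h0
      omega
    · rw [e, ih]

theorem slidePattern_le (g : ℕ → ℕ → ℕ) (r k s : ℕ) : slidePattern g r k s ≤ g k s := by
  unfold slidePattern; split <;> omega

theorem slidePattern_lt_iff {g : ℕ → ℕ → ℕ} (hg : IsPattern g) {r : ℕ} (hr : g 0 (r + 1) < g 0 r)
    (k s j : ℕ) : j < slidePattern g r k s ↔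
      j < g k s ∧ ¬(s = slideRow g r k ∧ j + 1 = g k s) := by
  have h0 := slideRow_corner hg hr k
  unfold slidePattern
  split
  · next h => subst h; omega
  · next h => simp [h]

/-- The rule of `slideRow` is forced by interlacing: shortening row `p` at level `k` breaks the
inequality with row `p + 1` at level `k + 1` exactly when this is an equality, and then that row
must be shortened too. It has room, by the corner condition. -/
theorem IsPattern.slidePattern {g : ℕ → ℕ → ℕ} (hg : IsPattern g) {r : ℕ}
    (hr : g 0 (r + 1) < g 0 r) : IsPattern (slidePattern g r) where
  mono k s := by
    have h0 := slideRow_corner hg hr k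
    have h1 := hg.mono k s
    unfold _root_.slidePattern
    rcases slideRow_succ_cases g r k with ⟨h, e⟩ | ⟨h, e⟩ <;> rw [e]
    · by_cases hs : s = slideRow g r k + 1
      · subst hs; simp; omega
      · rw [if_neg hs]; split <;> omega
    · split <;> omega
  interlace k s := by
    have h1 := hg.interlace k s
    unfold _root_.slidePattern
    rcases slideRow_succ_cases g r k with ⟨h, e⟩ | ⟨h, e⟩ <;> rw [e]
    · by_cases hs : s = slideRow g r k
      · subst hs; simp; omega
      · rw [if_neg hs]; split <;> omega
    · by_cases hs : s = slideRow g r k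
      · subst hs; simp; omega
      · rw [if_neg hs]; split <;> omega
  bounded := by
    obtain ⟨N, h1, h2⟩ := hg.bounded
    have hR := slideRow_eventually hg hr h1
    refine ⟨N, fun k hk => ?_, fun s hs => ?_⟩
    · funext s; unfold _root_.slidePattern; rw [hR k hk, h1 k hk]
    · have := slidePattern_le g r N s
      rw [h2 s hs] at this; omega

/-- A slide can be undone when the final partition is known. -/
theorem slidePattern_injective {g g' : ℕ → ℕ → ℕ} (hg : IsPattern g) (hg' : IsPattern g') {r : ℕ}
    (hr : g 0 (r + 1) < g 0 r) (hr' : g' 0 (r + 1) < g' 0 r)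
    (he : slidePattern g r = slidePattern g' r)
    (hfin : ∃ N, ∀ k, N ≤ k → g k = g' k) : g = g' := by
  have hval : ∀ k s, g k s = slidePattern g r k s + if s = slideRow g r k then 1 else 0 := by
    intro k s
    have := slideRow_corner hg hr k
    unfold slidePattern
    split
    · next h => subst h; omega
    · simp
  have hval' : ∀ k s, g' k s = slidePattern g r k s + if s = slideRow g' r k then 1 else 0 := by
    intro k s
    have := slideRow_corner hg' hr' k
    rw [he]
    unfold slidePattern
    split
    · next h => subst h; omega
    · simp
  -- The path can be traced backwards. If one path steps down from row `p` to `p + 1` while the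
  -- other is already in row `p + 1`, then at level `k` the second pattern has in row `p` one square
  -- less than the first, and its interlacing inequality fails there.
  have hback : ∀ k, slideRow g r (k + 1) = slideRow g' r (k + 1) →
      slideRow g r k = slideRow g' r k := by
    intro k hk
    have a := hval (k + 1) (slideRow g r (k + 1))
    have a' := hval' (k + 1) (slideRow g' r (k + 1))
    have b := hval k (slideRow g r k)
    have b' := hval' k (slideRow g' r k)
    rw [if_pos rfl] at a a' b b'
    have i1 := hg.interlace k (slideRow g' r k)
    have i2 := hg'.interlace k (slideRow g r k)
    have c := hval k (slideRow g' r k)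
    have c' := hval' k (slideRow g r k)
    rcases slideRow_succ_cases g r k with ⟨h, e⟩ | ⟨h, e⟩ <;>
      rcases slideRow_succ_cases g' r k with ⟨h', e'⟩ | ⟨h', e'⟩
    · omega
    · rw [e, e'] at hk
      rw [if_neg (by omega)] at c'
      rw [e] at a
      rw [e', ← hk] at a'
      omega
    · rw [e, e'] at hk
      rw [if_neg (by omega)] at c
      rw [e'] at a'
      rw [e, hk] at a
      omega
    · omega
  obtain ⟨N, hN⟩ := hfin
  have hlarge : ∀ k, N ≤ k → slideRow g r k = slideRow g' r k := by
    intro k hk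
    have a := hval k (slideRow g r k)
    have a' := hval' k (slideRow g r k)
    rw [hN k hk] at a
    rw [if_pos rfl] at a
    by_contra hne
    rw [if_neg hne] at a'
    omega
  have hall : ∀ k, slideRow g r k = slideRow g' r k := by
    intro k
    rcases le_total N k with h | h
    · exact hlarge k h
    · exact Nat.decreasingInduction' (P := fun k => slideRow g r k = slideRow g' r k)
        (fun k _ _ ih => hback k ih) h (hlarge N le_rfl)
  funext k s
  rw [hval, hval', hall]

/-! ### Raising operations on patterns -/

/-- The excess of letters `i` over letters `i + 1`, when reading by rows, at the
end of the letters `i + 1` of row `r`. -/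
def height (g : ℕ → ℕ → ℕ) (i r : ℕ) : ℤ :=
  ∑ s ∈ Finset.range r, ((g (i + 1) s : ℤ) - g i s) -
    ∑ s ∈ Finset.range (r + 1), ((g (i + 2) s : ℤ) - g (i + 1) s)

theorem height_zero (g : ℕ → ℕ → ℕ) (i : ℕ) : height g i 0 = g (i + 1) 0 - g (i + 2) 0 := by
  simp [height]

theorem height_succ (g : ℕ → ℕ → ℕ) (i r : ℕ) : height g i (r + 1) =
    height g i r + (g (i + 1) r - g (i + 2) (r + 1)) - (g i r - g (i + 1) (r + 1)) := by
  simp only [height, Finset.sum_range_succ _ r, Finset.sum_range_succ _ (r + 1)]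
  ring

/-- The position of the first minimum of `h`, supposed to be negative. -/
def IsRaiseRow (h : ℕ → ℤ) (r : ℕ) : Prop :=
  h r < 0 ∧ (∀ s, s < r → h r < h s) ∧ ∀ s, r ≤ s → h r ≤ h s

theorem IsRaiseRow.unique {h : ℕ → ℤ} {r s : ℕ} (hr : IsRaiseRow h r) (hs : IsRaiseRow h s) :
    r = s := by
  rcases lt_trichotomy r s with hlt | he | hlt
  · exact absurd (hs.2.1 r hlt) (not_lt.2 (hr.2.2 s hlt.le))
  · exact he
  · exact absurd (hr.2.1 s hlt) (not_lt.2 (hs.2.2 r hlt.le))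

/-- The pattern obtained by changing an entry `i + 1` of row `r` into `i`. -/
def raiseAt (g : ℕ → ℕ → ℕ) (i r : ℕ) : ℕ → ℕ → ℕ := fun k s =>
  if k = i + 1 ∧ s = r then g k s + 1 else g k s

theorem raiseAt_same (g : ℕ → ℕ → ℕ) (i r : ℕ) : raiseAt g i r (i + 1) r = g (i + 1) r + 1 := by
  simp [raiseAt]

theorem raiseAt_row {g : ℕ → ℕ → ℕ} {i r s : ℕ} (k : ℕ) (h : s ≠ r) :
    raiseAt g i r k s = g k s := by
  simp [raiseAt, h]

theorem raiseAt_level {g : ℕ → ℕ → ℕ} {i r k : ℕ} (h : k ≠ i + 1) :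
    raiseAt g i r k = g k := by
  funext s; simp [raiseAt, h]

theorem IsPattern.height_eventually {g : ℕ → ℕ → ℕ} (hg : IsPattern g) :
    ∃ N, ∀ i r, N ≤ r → height g i (r + 1) = height g i r := by
  obtain ⟨N, h1, h2⟩ := hg.bounded
  refine ⟨N, fun i r hr => ?_⟩
  have z : ∀ k s, N ≤ s → g k s = 0 := fun k s hs => by
    have := hg.le_of_bound h1 k s
    rw [h2 s hs] at this; omega
  rw [height_succ, z _ _ hr, z _ _ hr, z _ _ (hr.trans (Nat.le_succ r)),
    z _ _ (hr.trans (Nat.le_succ r))]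
  simp

/-- Heights are constant in all large rows, so a minimum is attained; its first position is the row
sought. -/
theorem IsPattern.exists_isRaiseRow {g : ℕ → ℕ → ℕ} (hg : IsPattern g) {i : ℕ}
    (h : ∃ r, height g i r < 0) : ∃ r, IsRaiseRow (height g i) r := by
  classical
  obtain ⟨N, hN⟩ := hg.height_eventually
  have hc : ∀ r, N ≤ r → height g i r = height g i N := by
    intro r hr
    induction r, hr using Nat.le_induction with
    | base => rfl
    | succ r hr ih => rw [hN i r hr, ih]
  obtain ⟨m, -, hm⟩ := (Finset.range (N + 1)).exists_min_image (height g i) ⟨0, by simp⟩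
  have hmin : ∀ s, height g i m ≤ height g i s := by
    intro s
    rcases le_total s N with hs | hs
    · exact hm s (by simp; omega)
    · rw [hc s hs]; exact hm N (by simp)
  have hex : ∃ r, ∀ s, height g i r ≤ height g i s := ⟨m, hmin⟩
  obtain ⟨r0, hr0⟩ := h
  refine ⟨Nat.find hex, (Nat.find_spec hex r0).trans_lt hr0, fun s hs => ?_,
    fun s _ => Nat.find_spec hex s⟩
  have hns := Nat.find_min hex hs
  push Not at hns
  obtain ⟨t, ht⟩ := hns
  exact (Nat.find_spec hex t).trans_lt ht

/-- The height drops strictly on entering the row of the first minimum. It could not drop if that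
row had no `i + 1`, nor if the first `i + 1` had an `i` or an inner-level boundary blocking it from
above, i.e. if `g (i+1) (s+1) = g i s`. These are the two inequalities that let the row grow. -/
theorem IsPattern.raiseAt_lt {g : ℕ → ℕ → ℕ} {i r : ℕ} (hg : IsPattern g)
    (h : IsRaiseRow (height g i) r) :
    g (i + 1) r < g (i + 2) r ∧ ∀ s, r = s + 1 → g (i + 1) r < g i s := by
  rcases r with _ | s
  · have := h.1
    rw [height_zero] at this
    exact ⟨by omega, fun s hs => by omega⟩
  · have a := h.2.1 s (Nat.lt_succ_self s)
    rw [height_succ] at a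
    have b := hg.interlace i s
    have c := hg.interlace (i + 1) s
    have d := hg.mono (i + 1) (s + 1)
    have e := hg.mono i s
    refine ⟨by lia, fun t ht => ?_⟩
    obtain rfl : s = t := by omega
    lia

theorem IsPattern.raiseAt {g : ℕ → ℕ → ℕ} {i r : ℕ} (hg : IsPattern g)
    (h : IsRaiseRow (height g i) r) : IsPattern (raiseAt g i r) where
  mono k s := by
    have h1 := hg.mono k s
    have h2 := (hg.raiseAt_lt h).1
    by_cases hs : s = r
    · subst hs
      by_cases hk : k = i + 1
      · subst hk
        rw [raiseAt_same, raiseAt_level (by omega)]; exact h2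
      · rw [raiseAt_level hk]
        refine h1.trans ?_
        unfold _root_.raiseAt; split <;> omega
    · rw [raiseAt_row _ hs, raiseAt_row _ hs]; exact h1
  interlace k s := by
    have h1 := hg.interlace k s
    have h2 := (hg.raiseAt_lt h).2 s
    by_cases hs : s + 1 = r
    · subst hs
      rw [raiseAt_row k (by omega : s ≠ s + 1)]
      by_cases hk : k = i
      · subst hk
        rw [raiseAt_same]; exact h2 rfl
      · rw [raiseAt_level (by omega)]; exact h1
    · rw [raiseAt_row _ hs]
      refine h1.trans ?_
      unfold _root_.raiseAt; split <;> omega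
  bounded := by
    obtain ⟨N, h1, h2⟩ := hg.bounded
    refine ⟨max N (max (i + 2) (r + 1)), fun k hk => ?_, fun s hs => ?_⟩
    · rw [raiseAt_level (by omega), raiseAt_level (by omega), h1 k (by omega),
        h1 (max N (max (i + 2) (r + 1))) (by omega)]
    · rw [raiseAt_level (by omega), h1 _ (by omega), h2 s (by omega)]

theorem height_raiseAt (g : ℕ → ℕ → ℕ) (i r s : ℕ) : height (raiseAt g i r) i s =
    height g i s + (if r < s then 1 else 0) + (if r ≤ s then 1 else 0) := by
  have hv : ∀ t, (raiseAt g i r (i + 1) t : ℤ) = g (i + 1) t + if t = r then 1 else 0 := by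
    intro t
    by_cases h : t = r
    · subst h; rw [raiseAt_same]; simp
    · rw [raiseAt_row _ h]; simp [h]
  have h1 : raiseAt g i r i = g i := raiseAt_level (by omega)
  have h2 : raiseAt g i r (i + 2) = g (i + 2) := raiseAt_level (by omega)
  simp only [height, hv, h1, h2, Finset.sum_sub_distrib, Finset.sum_add_distrib,
    Finset.sum_ite_eq', Finset.mem_range, Nat.lt_succ_iff]
  ring

/-- `g'` is the pattern obtained from `g` by the `i`-th raising operation. -/
def RaisesPattern (i : ℕ) (g g' : ℕ → ℕ → ℕ) : Prop :=
  ∃ r, IsRaiseRow (height g i) r ∧ g' = raiseAt g i r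

/-- Raising in row `r` adds 1 to the height at `r` and 2 to all later ones, so the first minimum
before the operation is the last minimum after it. The row can therefore be read off from the
result. -/
theorem RaisesPattern.injective {i : ℕ} {g₁ g₂ g : ℕ → ℕ → ℕ} (h₁ : RaisesPattern i g₁ g)
    (h₂ : RaisesPattern i g₂ g) : g₁ = g₂ := by
  obtain ⟨r₁, m₁, e₁⟩ := h₁
  obtain ⟨r₂, m₂, e₂⟩ := h₂
  have key : ∀ {f₁ f₂ : ℕ → ℕ → ℕ} {s₁ s₂ : ℕ}, IsRaiseRow (height f₁ i) s₁ →
      IsRaiseRow (height f₂ i) s₂ → raiseAt f₁ i s₁ = raiseAt f₂ i s₂ → s₁ ≤ s₂ := by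
    intro f₁ f₂ s₁ s₂ n₁ n₂ e
    by_contra! hlt
    have a := height_raiseAt f₁ i s₁ s₁
    have b := height_raiseAt f₁ i s₁ s₂
    have a' := height_raiseAt f₂ i s₂ s₁
    have b' := height_raiseAt f₂ i s₂ s₂
    have c := n₁.2.1 s₂ hlt
    have c' := n₂.2.2 s₁ hlt.le
    rw [e] at a b
    simp only [lt_irrefl, if_false, le_refl, if_true, not_lt.2 hlt.le, not_le.2 hlt, hlt, hlt.le]
      at a b a' b'
    lia
  have e : raiseAt g₁ i r₁ = raiseAt g₂ i r₂ := e₁ ▸ e₂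
  obtain rfl : r₁ = r₂ := le_antisymm (key m₁ m₂ e) (key m₂ m₁ e.symm)
  funext k s
  have := congrFun (congrFun e k) s
  unfold raiseAt at this
  split at this <;> omega

/-! ### Commutation of slides and raising operations on patterns -/

/-- A slide changes the row of a letter `k` only if the path steps down between levels `k` and `k +
1`; then one such letter moves up by one row. For `k = i` and for `k = i + 1` this affects the
height in the same single row `slideRow g r (i + 1)`, with opposite signs. -/
theorem height_slidePattern {g : ℕ → ℕ → ℕ} (hg : IsPattern g) {r : ℕ} (hr : g 0 (r + 1) < g 0 r)
    (i s : ℕ) : height (slidePattern g r) i s = height g i s +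
      if s = slideRow g r (i + 1) then
        ((slideRow g r (i + 1) : ℤ) - slideRow g r i) -
          (slideRow g r (i + 2) - slideRow g r (i + 1)) else 0 := by
  have hv : ∀ k t, (slidePattern g r k t : ℤ) = g k t - if t = slideRow g r k then 1 else 0 := by
    intro k t
    have := slideRow_corner hg hr k
    unfold slidePattern
    split
    · next h => subst h; omega
    · simp
  have h1 := slideRow_succ_cases g r i
  have h2 := slideRow_succ_cases g r (i + 1)
  simp only [height, hv, Finset.sum_sub_distrib, Finset.sum_ite_eq', Finset.mem_range,
    Nat.lt_succ_iff]
  generalize slideRow g r i = p at *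
  generalize slideRow g r (i + 1) = q at *
  rw [show i + 1 + 1 = i + 2 from rfl] at h2
  generalize slideRow g r (i + 2) = t at *
  split_ifs <;> lia

theorem slideRow_congr {g g' : ℕ → ℕ → ℕ} {r k : ℕ} (h : ∀ l, l ≤ k → g l = g' l) :
    slideRow g r k = slideRow g' r k := by
  induction k with
  | zero => rfl
  | succ k ih =>
    simp only [slideRow, ih fun l hl => h l (by omega), h k (by omega), h (k + 1) le_rfl]

theorem slideRow_congr_of_eq {g g' : ℕ → ℕ → ℕ} {r l : ℕ}
    (hl : slideRow g r l = slideRow g' r l) (h : ∀ k, l ≤ k → g k = g' k) (k : ℕ) (hk : l ≤ k) :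
    slideRow g r k = slideRow g' r k := by
  induction k, hk using Nat.le_induction with
  | base => exact hl
  | succ k hk ih => simp only [slideRow, ih, h k hk, h (k + 1) (by omega)]

/-- Slides preserve the Littlewood–Richardson condition. A height falls only if the path stays in
row `p` at level `i + 1` and steps down at level `i + 2`; in that case the original height at `p +
1` is already smaller than that at `p`. -/
theorem exists_height_neg_of_slidePattern {g : ℕ → ℕ → ℕ} (hg : IsPattern g) {r : ℕ}
    (hr : g 0 (r + 1) < g 0 r) {i : ℕ} (h : ∃ s, height (slidePattern g r) i s < 0) :
    ∃ s, height g i s < 0 := by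
  obtain ⟨s, hs⟩ := h
  rw [height_slidePattern hg hr] at hs
  by_cases e : s = slideRow g r (i + 1)
  · subst e
    rw [if_pos rfl] at hs
    have a := hg.interlace i (slideRow g r (i + 1))
    have b := height_succ g i (slideRow g r (i + 1))
    rcases slideRow_succ_cases g r i with ⟨h1, e1⟩ | ⟨h1, e1⟩ <;>
      rcases slideRow_succ_cases g r (i + 1) with ⟨h2, e2⟩ | ⟨h2, e2⟩
    · exact ⟨slideRow g r (i + 1), by lia⟩
    · exact ⟨slideRow g r (i + 1), by lia⟩
    · refine ⟨slideRow g r (i + 1) + 1, ?_⟩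
      rw [show i + 1 + 1 = i + 2 from rfl] at h2 e2
      rw [← e1] at h1
      lia
    · exact ⟨slideRow g r (i + 1), by lia⟩
  · rw [if_neg e] at hs
    exact ⟨s, by lia⟩

/-- Slides commute with raising operations. -/
theorem RaisesPattern.slide {g g' : ℕ → ℕ → ℕ} (hg : IsPattern g) {r : ℕ}
    (hr : g 0 (r + 1) < g 0 r) {i : ℕ} (h : RaisesPattern i g g') :
    RaisesPattern i (slidePattern g r) (slidePattern g' r) := by
  obtain ⟨m, hm, rfl⟩ := h
  have hlow : ∀ l, l ≤ i → raiseAt g i m l = g l := fun l hl => raiseAt_level (by omega)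
  have hhigh : ∀ l, i + 2 ≤ l → raiseAt g i m l = g l := fun l hl => raiseAt_level (by omega)
  have hp : ∀ l, l ≤ i → slideRow (raiseAt g i m) r l = slideRow g r l := fun l hl =>
    slideRow_congr fun k hk => hlow k (by omega)
  -- it suffices to know the new rows at the levels `i + 1` and `i + 2`
  have key : ∀ m', IsRaiseRow (height (slidePattern g r) i) m' →
      slideRow (raiseAt g i m) r (i + 2) = slideRow g r (i + 2) →
      (∀ s, slidePattern (raiseAt g i m) r (i + 1) s =
        slidePattern g r (i + 1) s + if s = m' then 1 else 0) →
      RaisesPattern i (slidePattern g r) (slidePattern (raiseAt g i m) r) := by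
    intro m' h1 h2 h3
    refine ⟨m', h1, ?_⟩
    have h4 := slideRow_congr_of_eq h2 hhigh
    funext k s
    rcases lt_trichotomy k (i + 1) with hk | rfl | hk
    · rw [raiseAt_level hk.ne]
      simp only [slidePattern, hp k (by omega), hlow k (by omega)]
    · rw [h3]
      unfold raiseAt
      by_cases hs : s = m' <;> simp [hs]
    · rw [raiseAt_level hk.ne']
      simp only [slidePattern, h4 k (by omega), hhigh k (by omega)]
  -- the case where the new row at the level `i + 1` is the old one
  have key' : IsRaiseRow (height (slidePattern g r) i) m →
      slideRow (raiseAt g i m) r (i + 2) = slideRow g r (i + 2) →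
      slideRow (raiseAt g i m) r (i + 1) = slideRow g r (i + 1) →
      RaisesPattern i (slidePattern g r) (slidePattern (raiseAt g i m) r) := by
    intro h1 h2 h3
    refine key m h1 h2 fun s => ?_
    have c := slideRow_corner hg hr (i + 1)
    simp only [slidePattern, h3]
    by_cases hs : s = m
    · subst hs
      rw [raiseAt_same, if_pos rfl]
      split
      · next e => rw [← e] at c; omega
      · rfl
    · rw [raiseAt_row _ hs, if_neg hs]; rfl
  have hH := height_slidePattern hg hr i
  have hs : ∀ p, height g i (p + 1) = _ := height_succ g i
  have iA := hg.interlace (i + 1)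
  have iB := hg.interlace i
  have c1 := slideRow_succ_cases g r i
  have c2 := slideRow_succ_cases g r (i + 1)
  have d1 := slideRow_succ_cases (raiseAt g i m) r i
  have d2 := slideRow_succ_cases (raiseAt g i m) r (i + 1)
  rw [hp i le_rfl, raiseAt_level (by omega : i ≠ i + 1)] at d1
  rw [show i + 1 + 1 = i + 2 from rfl, raiseAt_level (by omega : i + 2 ≠ i + 1)] at d2
  rw [show i + 1 + 1 = i + 2 from rfl] at c2 iA
  have rs := raiseAt_same g i m
  have rn : ∀ s, s ≠ m → raiseAt g i m (i + 1) s = g (i + 1) s := fun s hs => raiseAt_row _ hs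
  have hpos := slideRow_corner hg hr (i + 1)
  set p := slideRow g r i
  obtain ⟨hneg, hbefore, hafter⟩ := hm
  rcases c1 with ⟨h1, e1⟩ | ⟨h1, e1⟩ <;> rcases c2 with ⟨h2, e2⟩ | ⟨h2, e2⟩ <;>
    rw [e1] at h2 e2 hH hpos
  -- Down at both levels: heights are unchanged, and row `p + 1` of level `i + 1` is already as long
  -- as interlacing allows, so it is not the raised row and the path does not change.
  · have hne : p + 1 ≠ m := by
      rintro rfl
      have := hbefore p (by omega)
      have := hs p
      have := iA p
      lia
    rw [rn _ hne, h1] at d1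
    have f1 : slideRow (raiseAt g i m) r (i + 1) = p + 1 := by
      rcases d1 with d1 | d1
      · exact d1.2
      · exact absurd rfl d1.1
    rw [f1, rn _ hne, h2] at d2
    have f2 : slideRow (raiseAt g i m) r (i + 2) = p + 1 + 1 := by
      rcases d2 with d2 | d2
      · exact d2.2
      · exact absurd rfl d2.1
    refine key' ?_ (f2.trans e2.symm) (f1.trans e1.symm)
    have : height (slidePattern g r) i = height g i := by
      funext s; rw [hH s, e2]; split_ifs <;> lia
    rw [this]; exact ⟨hneg, hbefore, hafter⟩
  -- Down, then staying: the height grows by 1 at `p + 1`, which is again not the raised row, so the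
  -- first minimum survives.
  · have hne : p + 1 ≠ m := by
      rintro rfl
      have := hbefore p (by omega)
      have := hs p
      have := iA p
      lia
    rw [rn _ hne, h1] at d1
    have f1 : slideRow (raiseAt g i m) r (i + 1) = p + 1 := by
      rcases d1 with d1 | d1
      · exact d1.2
      · exact absurd rfl d1.1
    rw [f1, rn _ hne] at d2
    have f2 : slideRow (raiseAt g i m) r (i + 2) = p + 1 := by
      rcases d2 with d2 | d2
      · exact absurd d2.1 h2
      · exact d2.2
    refine key' ?_ (f2.trans e2.symm) (f1.trans e1.symm)
    have hH' : ∀ s, height (slidePattern g r) i s = height g i s + if s = p + 1 then 1 else 0 := by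
      intro s; rw [hH s, e2]; split_ifs <;> lia
    refine ⟨?_, fun s hs => ?_, fun s hs => ?_⟩
    · rw [hH' m, if_neg hne.symm]; lia
    · have := hbefore s hs
      rw [hH' m, hH' s, if_neg hne.symm]; split_ifs <;> lia
    · have := hafter s hs
      rw [hH' m, hH' s, if_neg hne.symm]; split_ifs <;> lia
  -- Staying, then down: the height falls by 1 at `p`, where it was larger than at `p + 1`.
  · have hH' : ∀ s, height (slidePattern g r) i s = height g i s - if s = p then 1 else 0 := by
      intro s; rw [hH s, e2]; split_ifs <;> lia
    have hp1 := hs p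
    have hB := iB p
    have hpm : p ≠ m := by
      rintro rfl
      have := hafter (p + 1) (by omega)
      lia
    -- The only case where anything moves. The height at `p` exceeds the minimum at `p + 1` by
    -- exactly 1, so after the slide the first minimum is `p`; correspondingly, raising in row `p +
    -- 1` makes the path step down one level earlier.
    by_cases hsub : m = p + 1 ∧ g i p = g (i + 1) (p + 1) + 1
    · obtain ⟨rfl, hB1⟩ := hsub
      have f1 : slideRow (raiseAt g i (p + 1)) r (i + 1) = p + 1 := by
        rcases d1 with d1 | d1
        · exact d1.2
        · exact absurd (rs.trans hB1.symm) d1.1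
      rw [f1, rs] at d2
      have f2 : slideRow (raiseAt g i (p + 1)) r (i + 2) = p + 1 := by
        rcases d2 with d2 | d2
        · have := iA (p + 1)
          omega
        · exact d2.2
      refine key p ⟨?_, fun s hs => ?_, fun s hs => ?_⟩ (f2.trans e2.symm) fun s => ?_
      · rw [hH' p, if_pos rfl]; lia
      · have := hbefore s (by omega)
        rw [hH' p, hH' s, if_pos rfl, if_neg (by omega)]; lia
      · rw [hH' p, hH' s, if_pos rfl]
        rcases hs.eq_or_lt with rfl | hs
        · simp
        · have := hafter s hs
          rw [if_neg (by omega)]; lia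
      · simp only [slidePattern, f1, e1]
        by_cases hs1 : s = p + 1
        · subst hs1
          rw [rs, if_pos rfl, if_neg (by omega), if_neg (by omega)]
          rfl
        · rw [if_neg hs1, rn s hs1]
          by_cases hs2 : s = p
          · subst hs2; simp only [if_true]; omega
          · rw [if_neg hs2, if_neg hs2]; rfl
    · have f1 : slideRow (raiseAt g i m) r (i + 1) = p := by
        rcases d1 with d1 | d1
        · exfalso
          by_cases hm : p + 1 = m
          · subst hm
            rw [rs] at d1
            exact hsub ⟨rfl, d1.1.symm⟩
          · rw [rn _ hm] at d1
            exact h1 d1.1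
        · exact d1.2
      rw [f1, rn _ hpm, h2] at d2
      have f2 : slideRow (raiseAt g i m) r (i + 2) = p + 1 := by
        rcases d2 with d2 | d2
        · exact d2.2
        · exact absurd rfl d2.1
      refine key' ⟨?_, fun s hs => ?_, fun s hs => ?_⟩ (f2.trans e2.symm) (f1.trans e1.symm)
      · rw [hH' m, if_neg hpm.symm]; lia
      · have := hbefore s hs
        rw [hH' m, hH' s, if_neg hpm.symm]
        split_ifs with hsp
        · subst hsp
          by_cases hm : p + 1 = m
          · subst hm
            have : g i p ≠ g (i + 1) (p + 1) + 1 := fun h => hsub ⟨rfl, h⟩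
            lia
          · have := hbefore (p + 1) (by omega)
            lia
        · lia
      · have := hafter s hs
        rw [hH' m, hH' s, if_neg hpm.symm]
        split_ifs with hsp
        · subst hsp
          have := hafter (p + 1) (by omega)
          lia
        · lia
  -- Staying at both levels: heights are unchanged. Raising could divert the path only by creating
  -- an equality of row lengths, which the strict drop of height at `m`, respectively interlacing,
  -- excludes.
  · have hH' : height (slidePattern g r) i = height g i := by
      funext s; rw [hH s, e2]; split_ifs <;> lia
    have hp1 := hs p
    have hA := iA p
    have f1 : slideRow (raiseAt g i m) r (i + 1) = p := by
      rcases d1 with d1 | d1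
      · exfalso
        by_cases hm : p + 1 = m
        · subst hm
          rw [rs] at d1
          have := hbefore p (by omega)
          lia
        · rw [rn _ hm] at d1
          exact h1 d1.1
      · exact d1.2
    rw [f1] at d2
    have f2 : slideRow (raiseAt g i m) r (i + 2) = p := by
      rcases d2 with d2 | d2
      · exfalso
        by_cases hm : p = m
        · subst hm
          rw [rs] at d2
          omega
        · rw [rn _ hm] at d2
          exact h2 d2.1
      · exact d2.2
    refine key' ?_ (f2.trans e2.symm) (f1.trans e1.symm)
    rw [hH']; exact ⟨hneg, hbefore, hafter⟩

/-! ### The pattern of a tableau -/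

/-- The Young diagram with row lengths `f`. -/
def rowDiagram (f : ℕ → ℕ) (hf : Antitone f) (N : ℕ) : YoungDiagram where
  cells := (Finset.range N ×ˢ Finset.range (f 0)).filter fun c => c.2 < f c.1
  isLowerSet := by
    rintro ⟨a, b⟩ ⟨c, d⟩ ⟨h1, h2⟩ h
    simp only [Finset.coe_filter, Finset.mem_product, Finset.mem_range, Set.mem_ofPred_eq] at h ⊢
    have e1 := hf h1
    have e2 := hf (Nat.zero_le c)
    have h1 : c ≤ a := h1
    have h2 : d ≤ b := h2
    simp only at e1
    omega

theorem mem_rowDiagram {f : ℕ → ℕ} (hf : Antitone f) {N : ℕ} (hN : ∀ r, N ≤ r → f r = 0)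
    (r j : ℕ) : (r, j) ∈ rowDiagram f hf N ↔ j < f r := by
  rw [← YoungDiagram.mem_cells]
  simp only [rowDiagram, Finset.mem_filter, Finset.mem_product, Finset.mem_range]
  refine ⟨fun h => h.2, fun h => ⟨⟨?_, h.trans_le (hf (Nat.zero_le r))⟩, h⟩⟩
  by_contra! hr
  rw [hN r hr] at h
  omega

namespace SkewSSYT

/-- The Young diagram formed by the inner shape and the squares with an entry less than `k`. -/
def level (T : SkewSSYT) (k : ℕ) : YoungDiagram where
  cells := T.outer.cells.filter fun c => c ∈ T.inner ∨ T.entry c.1 c.2 < k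
  isLowerSet := by
    rintro ⟨a, b⟩ ⟨c, d⟩ ⟨h1, h2⟩ h
    have h1 : c ≤ a := h1
    have h2 : d ≤ b := h2
    simp only [Finset.coe_filter, YoungDiagram.mem_cells, Set.mem_ofPred_eq] at h ⊢
    refine ⟨T.outer.up_left_mem h1 h2 h.1, ?_⟩
    by_cases hi : (c, d) ∈ T.inner
    · exact Or.inl hi
    · have hi' : (c, b) ∉ T.inner := fun h' => hi (T.inner.up_left_mem le_rfl h2 h')
      have hi'' : (a, b) ∉ T.inner := fun h' => hi (T.inner.up_left_mem h1 h2 h')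
      refine Or.inr ?_
      have e1 : T.entry c d ≤ T.entry c b := by
        rcases h2.eq_or_lt with rfl | h2
        · exact le_rfl
        · exact T.row_weak c d b h2 hi (T.outer.up_left_mem h1 le_rfl h.1)
      have e2 : T.entry c b ≤ T.entry a b := by
        rcases h1.eq_or_lt with rfl | h1
        · exact le_rfl
        · exact (T.col_strict c a b h1 hi' h.1).le
      have := h.2.resolve_left hi''
      omega

/-- The number of squares in row `r` of the diagram `T.level k`. -/
def pat (T : SkewSSYT) (k r : ℕ) : ℕ := (T.level k).rowLen r

theorem lt_pat_iff (T : SkewSSYT) (k r j : ℕ) :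
    j < T.pat k r ↔ (r, j) ∈ T.inner ∨ ((r, j) ∈ T.outer ∧ T.entry r j < k) := by
  unfold pat
  rw [← YoungDiagram.mem_iff_lt_rowLen, ← YoungDiagram.mem_cells]
  simp only [level, Finset.mem_filter, YoungDiagram.mem_cells]
  have : (r, j) ∈ T.inner → (r, j) ∈ T.outer := fun h => T.inner_le_outer h
  tauto

theorem lt_pat_zero_iff (T : SkewSSYT) (r j : ℕ) : j < T.pat 0 r ↔ (r, j) ∈ T.inner := by
  simp [lt_pat_iff]

theorem mem_outer_iff (T : SkewSSYT) (r j : ℕ) : (r, j) ∈ T.outer ↔ ∃ k, j < T.pat k r := by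
  simp only [lt_pat_iff]
  constructor
  · exact fun h => ⟨T.entry r j + 1, Or.inr ⟨h, Nat.lt_succ_self _⟩⟩
  · rintro ⟨k, h | h⟩
    · exact T.inner_le_outer h
    · exact h.1

theorem exists_entry_bound (T : SkewSSYT) : ∃ N, ∀ r j, T.entry r j < N := by
  refine ⟨(T.outer.cells.sup fun c => T.entry c.1 c.2) + 1, fun r j => Nat.lt_succ_of_le ?_⟩
  by_cases h : (r, j) ∈ T.outer
  · exact Finset.le_sup (f := fun c : ℕ × ℕ => T.entry c.1 c.2) h
  · rw [T.entry_eq_zero r j fun h' => h h'.1]; exact Nat.zero_le _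

theorem pat_eq_outer {T : SkewSSYT} {N : ℕ} (hN : ∀ r j, T.entry r j < N) {k : ℕ} (hk : N ≤ k)
    (r : ℕ) : T.pat k r = T.outer.rowLen r := by
  refine eq_of_forall_lt_iff fun j => ?_
  rw [lt_pat_iff, ← YoungDiagram.mem_iff_lt_rowLen]
  constructor
  · rintro (h | h)
    · exact T.inner_le_outer h
    · exact h.1
  · exact fun h => Or.inr ⟨h, (hN r j).trans_le hk⟩

theorem pat_zero (T : SkewSSYT) (r : ℕ) : T.pat 0 r = T.inner.rowLen r :=
  eq_of_forall_lt_iff fun j => by rw [lt_pat_zero_iff, YoungDiagram.mem_iff_lt_rowLen]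

theorem isPattern_pat (T : SkewSSYT) : IsPattern T.pat where
  mono k r := by
    refine le_of_forall_lt fun j => ?_
    simp only [lt_pat_iff]
    rintro (h | h)
    · exact Or.inl h
    · exact Or.inr ⟨h.1, by omega⟩
  interlace k r := by
    refine le_of_forall_lt fun j => ?_
    simp only [lt_pat_iff]
    rintro (h | h)
    · exact Or.inl (T.inner.up_left_mem (Nat.le_succ r) le_rfl h)
    · by_cases hi : (r, j) ∈ T.inner
      · exact Or.inl hi
      · have := T.col_strict r (r + 1) j (Nat.lt_succ_self r) hi h.1
        exact Or.inr ⟨T.outer.up_left_mem (Nat.le_succ r) le_rfl h.1, by omega⟩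
  bounded := by
    obtain ⟨N, hN⟩ := T.exists_entry_bound
    refine ⟨max N (T.outer.colLen 0), fun k hk => ?_, fun r hr => ?_⟩
    · funext r
      rw [pat_eq_outer hN (by omega), pat_eq_outer hN (by omega)]
    · rw [pat_eq_outer hN (by omega)]
      by_contra h
      have : (r, 0) ∈ T.outer := YoungDiagram.mem_iff_lt_rowLen.2 (Nat.pos_of_ne_zero h)
      rw [YoungDiagram.mem_iff_lt_colLen] at this
      omega

theorem entry_lt_iff {T : SkewSSYT} {r j : ℕ} (hi : (r, j) ∉ T.inner) (ho : (r, j) ∈ T.outer)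
    (k : ℕ) : T.entry r j < k ↔ j < T.pat k r := by
  rw [lt_pat_iff]; tauto

/-- A square that is, at every level, in both or in none of the chains of two tableaux, has the
same entry in both. -/
theorem entry_congr {T U : SkewSSYT} {r j : ℕ} (h : ∀ k, j < T.pat k r ↔ j < U.pat k r) :
    T.entry r j = U.entry r j := by
  have hi : (r, j) ∈ T.inner ↔ (r, j) ∈ U.inner := by
    rw [← lt_pat_zero_iff, h, lt_pat_zero_iff]
  have ho : (r, j) ∈ T.outer ↔ (r, j) ∈ U.outer := by
    simp only [mem_outer_iff, h]
  by_cases hT : (r, j) ∈ T.outer ∧ (r, j) ∉ T.inner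
  · have hU : (r, j) ∈ U.outer ∧ (r, j) ∉ U.inner := by rwa [← hi, ← ho]
    refine eq_of_forall_gt_iff fun k => ?_
    rw [entry_lt_iff hT.2 hT.1, entry_lt_iff hU.2 hU.1, h]
  · have hU : ¬((r, j) ∈ U.outer ∧ (r, j) ∉ U.inner) := by rwa [← hi, ← ho]
    rw [T.entry_eq_zero r j hT, U.entry_eq_zero r j hU]

theorem ext_of_pat {T U : SkewSSYT} (h : T.pat = U.pat) : T = U := by
  apply SkewSSYT.ext
  · ext ⟨r, j⟩
    simp only [YoungDiagram.mem_cells, mem_outer_iff, h]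
  · ext ⟨r, j⟩
    simp only [YoungDiagram.mem_cells, ← lt_pat_zero_iff, h]
  · funext r j
    exact entry_congr fun k => by rw [h]

theorem exists_pat_eq {g : ℕ → ℕ → ℕ} (hg : IsPattern g) : ∃ T : SkewSSYT, T.pat = g := by
  obtain ⟨N, h1, h2⟩ := hg.bounded
  have h2' : ∀ r, N ≤ r → g 0 r = 0 := fun r hr => by
    have := hg.le_of_bound h1 0 r
    rw [h2 r hr] at this; omega
  have mi := mem_rowDiagram (hg.antitone 0) h2'
  have mo := mem_rowDiagram (hg.antitone N) h2
  set inner := rowDiagram (g 0) (hg.antitone 0) N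
  set outer := rowDiagram (g N) (hg.antitone N) N
  -- The entry is the index of the step of the chain that adds the square. On inner squares this
  -- infimum is 0, and outside the outer shape it is that of the empty set, again 0, as required by
  -- `entry_eq_zero`.
  let entry : ℕ → ℕ → ℕ := fun r j => sInf {k | j < g (k + 1) r}
  have hle : ∀ r j k, j < g (k + 1) r → entry r j ≤ k := fun r j k h => Nat.sInf_le h
  have hspec : ∀ r j, j < g N r → j < g (entry r j + 1) r := fun r j h =>
    Nat.sInf_mem (s := {k | j < g (k + 1) r}) ⟨N, by
      change j < g (N + 1) r
      rwa [h1 (N + 1) (by omega)]⟩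
  have hlt : ∀ r j k, g 0 r ≤ j → j < g N r → (entry r j < k ↔ j < g k r) := by
    intro r j k h0 hN
    constructor
    · exact fun h => (hspec r j hN).trans_le (hg.mono_le h r)
    · intro h
      rcases k with _ | k
      · omega
      · exact Nat.lt_succ_of_le (hle r j k h)
  refine ⟨⟨outer, inner, ?_, entry, ?_, ?_, ?_⟩, ?_⟩
  · rintro ⟨r, j⟩ h
    exact (mo r j).2 (((mi r j).1 h).trans_le (hg.le_of_bound h1 0 r))
  · intro r j₁ j₂ hj _ ho
    exact hle _ _ _ (hj.trans (hspec r j₂ ((mo r j₂).1 ho)))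
  · intro r₁ r₂ j hr hi ho
    rw [mi] at hi
    rw [mo] at ho
    have ho' : j < g N r₁ := ho.trans_le (hg.antitone N hr.le)
    rw [hlt r₁ j _ (by omega) ho']
    exact ((hspec r₂ j ho).trans_le (hg.antitone _ hr)).trans_le (hg.interlace _ _)
  · intro r j h
    rw [mi, mo] at h
    by_cases h0 : j < g N r
    · have : j < g 0 r := by tauto
      exact Nat.le_zero.1 (hle r j 0 (this.trans_le (hg.mono 0 r)))
    · refine Nat.sInf_eq_zero.2 (Or.inr (Set.eq_empty_of_forall_notMem fun k hk => h0 ?_))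
      exact lt_of_lt_of_le hk (hg.le_of_bound h1 _ r)
  · funext k r
    refine eq_of_forall_lt_iff fun j => ?_
    rw [lt_pat_iff]
    simp only [mi, mo]
    by_cases h0 : j < g 0 r
    · simp only [h0, true_or, true_iff]
      exact h0.trans_le (hg.mono_le (Nat.zero_le k) r)
    · by_cases hN : j < g N r
      · rw [hlt r j k (by omega) hN]; tauto
      · have := hg.le_of_bound h1 k r
        simp only [h0, hN, false_and, or_false, false_iff]
        omega

end SkewSSYT

/-! ### Inward slides and patterns -/

namespace SkewSSYT

theorem mem_outer_iff_of_bound {T : SkewSSYT} {N : ℕ} (hN : ∀ k, N ≤ k → T.pat k = T.pat N)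
    (r j : ℕ) : (r, j) ∈ T.outer ↔ j < T.pat N r := by
  rw [mem_outer_iff]
  exact ⟨fun ⟨k, h⟩ => h.trans_le (T.isPattern_pat.le_of_bound hN k r), fun h => ⟨N, h⟩⟩

theorem entry_eq_of_lt_of_le {T : SkewSSYT} {k r j : ℕ} (h : T.pat k r ≤ j)
    (h' : j < T.pat (k + 1) r) : T.entry r j = k := by
  have hi : (r, j) ∉ T.inner := by
    rw [← lt_pat_zero_iff, not_lt]
    exact (T.isPattern_pat.mono_le (Nat.zero_le k) r).trans h
  have ho : (r, j) ∈ T.outer := (mem_outer_iff T r j).2 ⟨_, h'⟩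
  have a := entry_lt_iff hi ho k
  have b := entry_lt_iff hi ho (k + 1)
  omega

theorem le_entry {T : SkewSSYT} {k r j : ℕ} (h : T.pat k r ≤ j) (ho : (r, j) ∈ T.outer) :
    k ≤ T.entry r j := by
  have hi : (r, j) ∉ T.inner := by
    rw [← lt_pat_zero_iff, not_lt]
    exact (T.isPattern_pat.mono_le (Nat.zero_le k) r).trans h
  have a := entry_lt_iff hi ho k
  omega

/-- `T'` is obtained from `T` by a slide, in terms of patterns, into the corner of the inner shape
in row `r`. -/
def PatSlide (r : ℕ) (T T' : SkewSSYT) : Prop :=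
  T.pat 0 (r + 1) < T.pat 0 r ∧ T'.pat = slidePattern T.pat r

/-- The filling during a slide from `T` to `T'` when the empty square is `c`. -/
def slideFilling (T T' : SkewSSYT) (c : ℕ × ℕ) : ℕ → ℕ → ℕ := fun i j =>
  if (i, j) = c then 0 else if i < c.1 ∨ (i = c.1 ∧ j < c.2) then T'.entry i j else T.entry i j

namespace PatSlide

variable {r : ℕ} {T T' : SkewSSYT}

theorem lt_pat_iff (h : PatSlide r T T') (k i j : ℕ) : j < T'.pat k i ↔
    j < T.pat k i ∧ ¬(i = slideRow T.pat r k ∧ j + 1 = T.pat k i) := by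
  rw [h.2]; exact slidePattern_lt_iff T.isPattern_pat h.1 k i j

theorem entry_eq (h : PatSlide r T T') {i j : ℕ}
    (hij : ∀ k, i = slideRow T.pat r k → j + 1 ≠ T.pat k i) : T'.entry i j = T.entry i j :=
  entry_congr fun k => by
    have := hij k
    rw [h.lt_pat_iff]; tauto

/-- The equality of row lengths places a `k` directly below the empty square, while the entry to the
right is at least `k`. The tie rule thus agrees with the rule of `slideRow`. -/
theorem slideMove_up (h : PatSlide r T T') {k p m : ℕ} (hp : slideRow T.pat r k = p)
    (hm : T.pat k p = m + 1) (he : T.pat (k + 1) (p + 1) = T.pat k p) :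
    SlideMove T.outer ((p, m), slideFilling T T' (p, m))
      ((p + 1, m), slideFilling T T' (p + 1, m)) := by
  have hc := slideRow_corner T.isPattern_pat h.1 k
  rw [hp] at hc
  have hR : slideRow T.pat r (k + 1) = p + 1 := by simp [slideRow, hp, he]
  have hmono := T.isPattern_pat.mono k p
  have e1 : T.entry (p + 1) m = k := entry_eq_of_lt_of_le (by omega) (by omega)
  have e2 : T'.entry p m = k := by
    apply entry_eq_of_lt_of_le
    · rw [← not_lt, h.lt_pat_iff]; omega
    · rw [h.lt_pat_iff]; omega
  have e3 : slideFilling T T' (p + 1, m) =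
      moveEntry (slideFilling T T' (p, m)) (p + 1, m) (p, m) := by
    funext i j
    by_cases h1 : i = p ∧ j = m
    · obtain ⟨rfl, rfl⟩ := h1
      simp [moveEntry, slideFilling, e1, e2]
    by_cases h2 : i = p + 1 ∧ j = m
    · obtain ⟨rfl, rfl⟩ := h2
      simp [moveEntry, slideFilling]
    simp only [moveEntry, slideFilling, Prod.mk.injEq, h1, h2, if_false]
    -- Besides the two ends of the move, the fillings can differ only right of column `m` in row `p`
    -- and left of it in row `p + 1`. The path avoids these squares, so old and new entries agree
    -- there.
    by_cases h3 : i = p ∧ m < j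
    · rw [if_pos (by omega), if_neg (by omega)]
      refine h.entry_eq fun l hl => ?_
      rcases le_or_gt l k with hlk | hlk
      · have := T.isPattern_pat.mono_le hlk i
        rw [h3.1] at this ⊢
        omega
      · have := slideRow_mono T.pat r (show k + 1 ≤ l from hlk)
        omega
    by_cases h4 : i = p + 1 ∧ j < m
    · rw [if_pos (by omega), if_neg (by omega)]
      refine h.entry_eq fun l hl => ?_
      rcases le_or_gt l k with hlk | hlk
      · have := slideRow_mono T.pat r hlk
        omega
      · have := T.isPattern_pat.mono_le (show k + 1 ≤ l from hlk) i
        rw [h4.1] at this ⊢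
        omega
    split_ifs <;> first | rfl | omega
  rw [e3]
  refine SlideMove.up p m _ ((mem_outer_iff T _ _).2 ⟨k + 1, by omega⟩) fun ho => ?_
  have e4 : k ≤ T.entry p (m + 1) := le_entry (by omega) ho
  simpa [slideFilling, e1] using e4

theorem slideMove_left (h : PatSlide r T T') {k p m : ℕ} (hp : slideRow T.pat r k = p)
    (he : T.pat (k + 1) (p + 1) ≠ T.pat k p) (hm : T.pat k p ≤ m + 1)
    (hm' : m + 1 < T.pat (k + 1) p) :
    SlideMove T.outer ((p, m), slideFilling T T' (p, m))
      ((p, m + 1), slideFilling T T' (p, m + 1)) := by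
  have hc := slideRow_corner T.isPattern_pat h.1 k
  rw [hp] at hc
  have hR : slideRow T.pat r (k + 1) = p := by simp [slideRow, hp, he]
  have hint := T.isPattern_pat.interlace k p
  have e1 : T.entry p (m + 1) = k := entry_eq_of_lt_of_le hm hm'
  have e2 : T'.entry p m = k := by
    apply entry_eq_of_lt_of_le
    · rw [← not_lt, h.lt_pat_iff]; omega
    · rw [h.lt_pat_iff]; omega
  have e3 : slideFilling T T' (p, m + 1) =
      moveEntry (slideFilling T T' (p, m)) (p, m + 1) (p, m) := by
    funext i j
    by_cases h1 : i = p ∧ j = m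
    · obtain ⟨rfl, rfl⟩ := h1
      simp [moveEntry, slideFilling, e1, e2]
    by_cases h2 : i = p ∧ j = m + 1
    · obtain ⟨rfl, rfl⟩ := h2
      simp [moveEntry, slideFilling]
    simp only [moveEntry, slideFilling, Prod.mk.injEq, h1, h2, if_false]
    split_ifs <;> first | rfl | omega
  rw [e3]
  refine SlideMove.left p m _ ((mem_outer_iff T _ _).2 ⟨k + 1, hm'⟩) fun ho => ?_
  have e4 : k + 1 ≤ T.entry (p + 1) m := le_entry (by omega) ho
  simp only [slideFilling, Prod.mk.injEq]
  rw [if_neg (by omega), if_neg (by omega), if_neg (by omega), if_neg (by omega)]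
  omega

/-- Once the letters less than `k` have been handled, the empty square is the last one of its row at
level `k`. The letters `k` then contribute either one upward move or a run of leftward moves. -/
theorem reflTransGen_level (h : PatSlide r T T') (k : ℕ) :
    Relation.ReflTransGen (SlideMove T.outer)
      ((r, T.pat 0 r - 1), slideFilling T T' (r, T.pat 0 r - 1))
      ((slideRow T.pat r k, T.pat k (slideRow T.pat r k) - 1),
        slideFilling T T' (slideRow T.pat r k, T.pat k (slideRow T.pat r k) - 1)) := by
  induction k with
  | zero => exact Relation.ReflTransGen.refl
  | succ k ih =>
    refine ih.trans ?_
    have hc := slideRow_corner T.isPattern_pat h.1 k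
    rcases slideRow_succ_cases T.pat r k with ⟨he, e⟩ | ⟨he, e⟩ <;> rw [e]
    · rw [he]
      exact Relation.ReflTransGen.single (h.slideMove_up rfl (by omega) he)
    · have hmono := T.isPattern_pat.mono k (slideRow T.pat r k)
      have key : ∀ t, T.pat k (slideRow T.pat r k) - 1 ≤ t →
          t + 1 ≤ T.pat (k + 1) (slideRow T.pat r k) →
          Relation.ReflTransGen (SlideMove T.outer)
            ((slideRow T.pat r k, T.pat k (slideRow T.pat r k) - 1),
              slideFilling T T' (slideRow T.pat r k, T.pat k (slideRow T.pat r k) - 1))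
            ((slideRow T.pat r k, t), slideFilling T T' (slideRow T.pat r k, t)) := by
        intro t ht
        induction t, ht using Nat.le_induction with
        | base => exact fun _ => Relation.ReflTransGen.refl
        | succ t ht ih =>
          intro h'
          exact (ih (by omega)).tail (h.slideMove_left rfl he (by omega) (by omega))
      exact key _ (by omega) (by omega)

theorem inwardSlide (h : PatSlide r T T') : InwardSlide T T' := by
  obtain ⟨N, hN, -⟩ := T.isPattern_pat.bounded
  obtain ⟨N', hN', -⟩ := T'.isPattern_pat.bounded
  have hT : ∀ k, max N N' ≤ k → T.pat k = T.pat (max N N') := fun k hk => by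
    rw [hN k (by omega), hN (max N N') (by omega)]
  have hT' : ∀ k, max N N' ≤ k → T'.pat k = T'.pat (max N N') := fun k hk => by
    rw [hN' k (by omega), hN' (max N N') (by omega)]
  generalize max N N' = n at hT hT'
  have hc := slideRow_corner T.isPattern_pat h.1 n
  have hev := slideRow_eventually T.isPattern_pat h.1 hT
  have hpath := h.reflTransGen_level n
  have hstart : slideFilling T T' (r, T.pat 0 r - 1) = T.entry := by
    have h0 := h.1
    funext i j
    simp only [slideFilling, Prod.mk.injEq]
    split_ifs with h1 h2
    · obtain ⟨rfl, rfl⟩ := h1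
      refine (T.entry_eq_zero _ _ fun h' => h'.2 ?_).symm
      rw [← lt_pat_zero_iff]; omega
    · refine h.entry_eq fun l hl hj => ?_
      have := slideRow_mono T.pat r (Nat.zero_le l)
      simp only [slideRow] at this
      rcases h2 with h2 | ⟨rfl, h2⟩
      · omega
      · have := T.isPattern_pat.mono_le (Nat.zero_le l) i
        omega
    · rfl
  generalize hp : slideRow T.pat r n = p at hc hev hpath
  have hfinal : slideFilling T T' (p, T.pat n p - 1) = T'.entry := by
    funext i j
    simp only [slideFilling, Prod.mk.injEq]
    split_ifs with h1 h2
    · obtain ⟨rfl, rfl⟩ := h1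
      refine (T'.entry_eq_zero _ _ fun h' => ?_).symm
      have := h'.1
      rw [mem_outer_iff_of_bound hT', h.lt_pat_iff] at this
      omega
    · rfl
    · refine (h.entry_eq fun l hl hj => ?_).symm
      have hle : l ≤ n → slideRow T.pat r l ≤ p := fun hl => hp ▸ slideRow_mono T.pat r hl
      have hge : n ≤ l → slideRow T.pat r l = p := hev l
      have : i = p := by
        rcases le_total l n with h' | h'
        · have := hle h'; omega
        · have := hge h'; omega
      subst this
      have := T.isPattern_pat.le_of_bound hT l i
      omega
  rw [hstart, hfinal] at hpath
  have h0 := h.1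
  refine ⟨_, ?_, _, ?_, ?_, ?_, ?_, ?_, hpath⟩
  · rw [← lt_pat_zero_iff]; omega
  · rw [mem_outer_iff_of_bound hT]; omega
  · ext ⟨i, j⟩
    simp only [Finset.mem_erase, YoungDiagram.mem_cells, ← lt_pat_zero_iff, h.lt_pat_iff, ne_eq,
      Prod.mk.injEq]
    simp only [slideRow]
    constructor
    · rintro ⟨h1, h2⟩
      exact ⟨fun h3 => h2 ⟨h3.1, by rw [h3.1]; omega⟩, h1⟩
    · rintro ⟨h1, h2⟩
      exact ⟨h2, fun h3 => h1 ⟨h3.1, by rw [← h3.1]; omega⟩⟩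
  · ext ⟨i, j⟩
    simp only [Finset.mem_erase, YoungDiagram.mem_cells, mem_outer_iff_of_bound hT,
      mem_outer_iff_of_bound hT', h.lt_pat_iff, ne_eq, Prod.mk.injEq, hp]
    constructor
    · rintro ⟨h1, h2⟩
      exact ⟨fun h3 => h2 ⟨h3.1, by rw [h3.1]; omega⟩, h1⟩
    · rintro ⟨h1, h2⟩
      exact ⟨h2, fun h3 => h1 ⟨h3.1, by rw [← h3.1]; omega⟩⟩
  · rw [mem_outer_iff_of_bound hT]; simp only; omega
  · rw [mem_outer_iff_of_bound hT]; simp only; omega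

theorem unique {U : SkewSSYT} (h : PatSlide r T T') (h' : PatSlide r T U) : T' = U :=
  ext_of_pat (h.2.trans h'.2.symm)

theorem exists_of_corner (h : T.pat 0 (r + 1) < T.pat 0 r) : ∃ T', PatSlide r T T' := by
  obtain ⟨T', hT'⟩ := exists_pat_eq (T.isPattern_pat.slidePattern h)
  exact ⟨T', h, hT'⟩

end PatSlide

/-! ### Determinism of slides -/

theorem SlideMove.functional {D : YoungDiagram} {a b c : (ℕ × ℕ) × (ℕ → ℕ → ℕ)}
    (hb : SlideMove D a b) (hc : SlideMove D a c) : b = c := by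
  cases hb with
  | up i j f below le =>
    cases hc with
    | up => rfl
    | left _ _ _ right lt => exact absurd (lt below) (not_lt.2 (le right))
  | left i j f right lt =>
    cases hc with
    | up _ _ _ below le => exact absurd (lt below) (not_lt.2 (le right))
    | left => rfl

theorem SlideMove.not_of_corner {D : YoungDiagram} {d : ℕ × ℕ} {f : ℕ → ℕ → ℕ}
    {b : (ℕ × ℕ) × (ℕ → ℕ → ℕ)} (h₁ : (d.1 + 1, d.2) ∉ D) (h₂ : (d.1, d.2 + 1) ∉ D) :
    ¬SlideMove D (d, f) b := by
  intro h
  cases h with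
  | up i j f below le => exact h₁ below
  | left i j f right lt => exact h₂ right

end SkewSSYT

/-- A functional relation reaches at most one terminal object. -/
theorem eq_of_reflTransGen_terminal {α : Type*} {r : α → α → Prop}
    (hr : ∀ a b c, r a b → r a c → b = c) {a b c : α} (hab : Relation.ReflTransGen r a b)
    (hac : Relation.ReflTransGen r a c) (hb : IsNormal r b) (hc : IsNormal r c) : b = c := by
  induction hab using Relation.ReflTransGen.head_induction_on with
  | refl =>
    rcases hac.cases_head with h | ⟨x, h, -⟩
    · exact h
    · exact absurd h (hb x)
  | head hx _ ih =>
    rcases hac.cases_head with h | ⟨y, h, h'⟩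
    · subst h; exact absurd hx (hc _)
    · exact ih (hr _ _ _ h hx ▸ h')

namespace SkewSSYT

/-- For the direction from slides to patterns, the pattern slide into the same corner is realised by
some inward slide. Moves are deterministic and both paths stop only at terminal squares, so the two
slides have the same result. -/
theorem inwardSlide_iff {T T' : SkewSSYT} : InwardSlide T T' ↔ ∃ r, PatSlide r T T' := by
  refine ⟨fun h => ?_, fun ⟨r, h⟩ => h.inwardSlide⟩
  obtain ⟨c, hc, d, hd, hin, hout, hd1, hd2, hpath⟩ := h
  obtain ⟨r, m⟩ := c
  have hmem : ∀ i j, (i, j) ∈ T'.inner ↔ (i, j) ≠ (r, m) ∧ (i, j) ∈ T.inner := fun i j => by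
    rw [← YoungDiagram.mem_cells, hin, Finset.mem_erase, YoungDiagram.mem_cells]
  have hnot : (r, m) ∉ T'.inner := fun h => ((hmem r m).1 h).1 rfl
  have hright : (r, m + 1) ∉ T.inner := fun h => hnot
    (T'.inner.up_left_mem le_rfl (Nat.le_succ m) ((hmem r (m + 1)).2 ⟨by simp, h⟩))
  have hbelow : (r + 1, m) ∉ T.inner := fun h => hnot
    (T'.inner.up_left_mem (Nat.le_succ r) le_rfl ((hmem (r + 1) m).2 ⟨by simp, h⟩))
  rw [← lt_pat_zero_iff] at hc hright hbelow
  obtain ⟨U, hU⟩ := PatSlide.exists_of_corner (T := T) (r := r) (by omega)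
  have hm : T.pat 0 r = m + 1 := by omega
  obtain ⟨c', hc', d', hd', hin', hout', hd1', hd2', hpath'⟩ := hU.inwardSlide
  have hcc : c' = (r, m) := by
    have h1 := hU.lt_pat_iff 0 r m
    rw [lt_pat_zero_iff, lt_pat_zero_iff] at h1
    have h2 : (r, m) ∉ U.inner := fun h => (h1.1 h).2 ⟨rfl, hm.symm⟩
    rw [← YoungDiagram.mem_cells, hin', Finset.mem_erase, YoungDiagram.mem_cells] at h2
    have h3 : (r, m) ∈ T.inner := by rwa [← lt_pat_zero_iff]
    by_contra h4
    exact h2 ⟨fun h => h4 h.symm, h3⟩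
  subst hcc
  have hn : IsNormal (SlideMove T.outer) (d, T'.entry) := fun _ => SlideMove.not_of_corner hd1 hd2
  have hn' : IsNormal (SlideMove T.outer) (d', U.entry) := fun _ =>
    SlideMove.not_of_corner hd1' hd2'
  have hend := eq_of_reflTransGen_terminal (r := SlideMove T.outer)
    (fun _ _ _ => SlideMove.functional) hpath hpath' hn hn'
  simp only [Prod.mk.injEq] at hend
  obtain ⟨rfl, he⟩ := hend
  have : T' = U := by
    apply SkewSSYT.ext
    · ext1; rw [hout, hout']
    · ext1; rw [hin, hin']
    · exact he
  exact ⟨r, this ▸ hU⟩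

end SkewSSYT

/-! ### Raising operations and patterns -/

namespace SkewSSYT

theorem mem_cells_iff (T : SkewSSYT) (c : ℕ × ℕ) : c ∈ T.cells ↔ c ∈ T.outer ∧ c ∉ T.inner := by
  simp [cells, YoungDiagram.mem_cells]

theorem mem_cells_and_entry_iff (T : SkewSSYT) (k : ℕ) (c : ℕ × ℕ) :
    c ∈ T.cells ∧ T.entry c.1 c.2 = k ↔ T.pat k c.1 ≤ c.2 ∧ c.2 < T.pat (k + 1) c.1 := by
  obtain ⟨r, j⟩ := c
  rw [mem_cells_iff]
  constructor
  · rintro ⟨⟨ho, hi⟩, he⟩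
    have a := entry_lt_iff hi ho k
    have b := entry_lt_iff hi ho (k + 1)
    simp only at he ⊢
    omega
  · rintro ⟨h1, h2⟩
    refine ⟨⟨(mem_outer_iff T r j).2 ⟨_, h2⟩, ?_⟩, entry_eq_of_lt_of_le h1 h2⟩
    rw [← lt_pat_zero_iff, not_lt]
    exact (T.isPattern_pat.mono_le (Nat.zero_le k) r).trans h1

/-- The squares with entry `k` in the first `n` rows of `T`. -/
def lettersAbove (T : SkewSSYT) (k n : ℕ) : Finset (ℕ × ℕ) :=
  (Finset.range n).biUnion fun s =>
    (Finset.Ico (T.pat k s) (T.pat (k + 1) s)).map (Function.Embedding.sectR s ℕ)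

theorem mem_lettersAbove (T : SkewSSYT) (k n : ℕ) (c : ℕ × ℕ) :
    c ∈ T.lettersAbove k n ↔ c.1 < n ∧ c ∈ T.cells ∧ T.entry c.1 c.2 = k := by
  rw [mem_cells_and_entry_iff]
  obtain ⟨r, j⟩ := c
  simp only [lettersAbove, Finset.mem_biUnion, Finset.mem_range, Finset.mem_map, Finset.mem_Ico,
    Function.Embedding.sectR_apply, Prod.mk.injEq]
  constructor
  · rintro ⟨s, hs, m, hm, rfl, rfl⟩
    exact ⟨hs, hm⟩
  · rintro ⟨hs, hm⟩
    exact ⟨r, hs, j, hm, rfl, rfl⟩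

theorem card_lettersAbove (T : SkewSSYT) (k n : ℕ) : ((T.lettersAbove k n).card : ℤ) =
    ∑ s ∈ Finset.range n, ((T.pat (k + 1) s : ℤ) - T.pat k s) := by
  unfold lettersAbove
  rw [Finset.card_biUnion]
  · push_cast
    refine Finset.sum_congr rfl fun s _ => ?_
    have := T.isPattern_pat.mono k s
    rw [Finset.card_map, Nat.card_Ico]
    omega
  · intro s _ t _ hst
    rw [Function.onFun, Finset.disjoint_left]
    simp only [Finset.mem_map, Function.Embedding.sectR_apply]
    rintro _ ⟨a, _, rfl⟩ ⟨b, _, hb⟩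
    exact hst (congrArg Prod.fst hb).symm

theorem height_pat (T : SkewSSYT) (i r : ℕ) : height T.pat i r =
    (T.lettersAbove i r).card - (T.lettersAbove (i + 1) (r + 1)).card := by
  rw [card_lettersAbove, card_lettersAbove, height]

/-! ### Reading words and their excess -/

theorem count_readWord (T : SkewSSYT) {l : List (ℕ × ℕ)} (hl : l.Nodup) (k : ℕ) :
    (T.readWord l).count k = (l.toFinset.filter fun c => T.entry c.1 c.2 = k).card := by
  have : l.toFinset.filter (fun c => T.entry c.1 c.2 = k) =
      (l.filter fun c => T.entry c.1 c.2 = k).toFinset := by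
    ext c; simp
  rw [this, List.toFinset_card_of_nodup (hl.filter _), readWord, List.count_eq_countP,
    List.countP_map, List.countP_eq_length_filter]
  congr 1

theorem readWord_append (T : SkewSSYT) (l l' : List (ℕ × ℕ)) :
    T.readWord (l ++ l') = T.readWord l ++ T.readWord l' := List.map_append

theorem readWord_cons (T : SkewSSYT) (c : ℕ × ℕ) (l : List (ℕ × ℕ)) :
    T.readWord (c :: l) = T.entry c.1 c.2 :: T.readWord l := rfl

/-- The number of letters `i` of `w` minus the number of letters `i + 1`. -/
def excess (i : ℕ) (w : List ℕ) : ℤ := w.count i - w.count (i + 1)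

theorem excess_append (i : ℕ) (v w : List ℕ) : excess i (v ++ w) = excess i v + excess i w := by
  simp only [excess, List.count_append]; push_cast; ring

theorem excess_cons_succ (i : ℕ) (w : List ℕ) : excess i ((i + 1) :: w) = excess i w - 1 := by
  simp [excess]; ring

theorem excess_cons_of_ne {i a : ℕ} (h : a ≠ i + 1) (w : List ℕ) :
    excess i w ≤ excess i (a :: w) := by
  simp only [excess, List.count_cons, beq_iff_eq, if_neg h]
  split_ifs <;> push_cast <;> omega

theorem excess_nil (i : ℕ) : excess i [] = 0 := rfl

/-- Up to the leftmost entry `i + 1` of a row, the letters `i` and `i + 1` are read in the same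
order for all valid reading orders. -/
theorem excess_readWord_of_isReadingOrder {T : SkewSSYT} {i r : ℕ} {l₁ l₂ : List (ℕ × ℕ)}
    (hs : T.IsReadingOrder (l₁ ++ (r, T.pat (i + 1) r) :: l₂))
    (hr : T.pat (i + 1) r < T.pat (i + 2) r) :
    excess i (T.readWord l₁) = height T.pat i r + 1 := by
  obtain ⟨hnd, hmem, hpw⟩ := hs
  have hT := T.isPattern_pat
  have hlist : ∀ c, c ∈ T.cells ↔ c ∈ l₁ ∨ c = (r, T.pat (i + 1) r) ∨ c ∈ l₂ := fun c => by
    rw [← hmem]; simp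
  rw [List.pairwise_append, List.pairwise_cons] at hpw
  obtain ⟨-, ⟨hpw2, -⟩, hpw1⟩ := hpw
  have hl1 : ∀ c ∈ l₁, ¬(r ≤ c.1 ∧ c.2 ≤ T.pat (i + 1) r) := fun c hc =>
    hpw1 c hc _ List.mem_cons_self
  have hl2 : ∀ c ∈ l₂, ¬(c.1 ≤ r ∧ T.pat (i + 1) r ≤ c.2) := hpw2
  have hnd1 : l₁.Nodup := (List.nodup_append.1 hnd).1
  have hq : (r, T.pat (i + 1) r) ∉ l₁ := fun h => by
    have := hl1 _ h
    simp at this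
  have hqe : (r, T.pat (i + 1) r) ∈ T.cells ∧ T.entry r (T.pat (i + 1) r) = i + 1 :=
    (mem_cells_and_entry_iff T (i + 1) (r, T.pat (i + 1) r)).2 ⟨le_rfl, hr⟩
  have h1 : (l₁.toFinset.filter fun c => T.entry c.1 c.2 = i) = T.lettersAbove i r := by
    ext c
    rw [mem_lettersAbove, Finset.mem_filter, List.mem_toFinset]
    constructor
    · rintro ⟨hc, he⟩
      have hcc := (hlist c).2 (Or.inl hc)
      refine ⟨?_, hcc, he⟩
      have ha := (mem_cells_and_entry_iff T i c).1 ⟨hcc, he⟩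
      by_contra! hlt
      exact hl1 c hc ⟨hlt, ha.2.le.trans (hT.antitone _ hlt)⟩
    · rintro ⟨hc, hcc, he⟩
      refine ⟨?_, he⟩
      have ha := (mem_cells_and_entry_iff T i c).1 ⟨hcc, he⟩
      rcases (hlist c).1 hcc with h | h | h
      · exact h
      · rw [h] at hc; exact absurd hc (lt_irrefl _)
      · refine absurd ⟨hc.le, ?_⟩ (hl2 c h)
        exact ((hT.antitone _ (Nat.succ_le_of_lt hc)).trans (hT.interlace i c.1)).trans ha.1
  have h2 : insert (r, T.pat (i + 1) r) (l₁.toFinset.filter fun c => T.entry c.1 c.2 = i + 1) =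
      T.lettersAbove (i + 1) (r + 1) := by
    ext c
    rw [mem_lettersAbove, Finset.mem_insert, Finset.mem_filter, List.mem_toFinset]
    constructor
    · rintro (rfl | ⟨hc, he⟩)
      · exact ⟨Nat.lt_succ_self r, hqe⟩
      · have hcc := (hlist c).2 (Or.inl hc)
        refine ⟨?_, hcc, he⟩
        have ha := (mem_cells_and_entry_iff T (i + 1) c).1 ⟨hcc, he⟩
        by_contra! hlt
        refine hl1 c hc ⟨by omega, ha.2.le.trans ?_⟩
        exact (hT.antitone _ hlt).trans (hT.interlace (i + 1) r)
    · rintro ⟨hc, hcc, he⟩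
      have ha := (mem_cells_and_entry_iff T (i + 1) c).1 ⟨hcc, he⟩
      rcases (hlist c).1 hcc with h | h | h
      · exact Or.inr ⟨h, he⟩
      · exact Or.inl h
      · exact absurd ⟨Nat.lt_succ_iff.1 hc, (hT.antitone _ (Nat.lt_succ_iff.1 hc)).trans ha.1⟩
          (hl2 c h)
  rw [height_pat, ← h1, ← h2, Finset.card_insert_of_notMem (by simp [hq]), excess,
    count_readWord T hnd1, count_readWord T hnd1]
  push_cast
  ring

theorem height_eq_of_append {T : SkewSSYT} {i : ℕ} {p : ℕ × ℕ} {l₁ l₂ : List (ℕ × ℕ)}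
    (hs : T.IsReadingOrder (l₁ ++ p :: l₂)) (hp : p.2 = T.pat (i + 1) p.1)
    (hlt : T.pat (i + 1) p.1 < T.pat (i + 2) p.1) :
    height T.pat i p.1 = excess i (T.readWord l₁) - 1 := by
  obtain ⟨r, j⟩ := p
  simp only at hp hlt
  subst hp
  rw [excess_readWord_of_isReadingOrder hs hlt]; ring

/-- The height at a row containing an `i + 1` is the excess just after its leftmost one, for every
valid reading order. The conditions on `u` and `v` compare these excesses with the one at the
changed letter, and say that it is a negative first minimum. -/
theorem Raises.raisesPattern {i : ℕ} {T U : SkewSSYT} (h : Raises i T U) :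
    RaisesPattern i T.pat U.pat := by
  obtain ⟨hout, hin, s, hs, u, v, hw, hw', hu, hv⟩ := h
  obtain ⟨l₁, l₂', rfl, hl₁, hl₂'⟩ := List.map_eq_append_iff.1 hw
  obtain ⟨p, l₂, rfl, hp, hl₂⟩ := List.map_eq_cons_iff.1 hl₂'
  change T.readWord l₁ = u at hl₁
  change T.readWord l₂ = v at hl₂
  have hT := T.isPattern_pat
  have hU : U.readWord l₁ = u ∧ U.entry p.1 p.2 = i ∧ U.readWord l₂ = v := by
    rw [readWord_append, readWord_cons] at hw'
    have hlen : (U.readWord l₁).length = u.length := by rw [← hl₁]; simp [readWord]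
    have := List.append_inj hw' hlen
    simpa using this
  have heq : ∀ c, c ≠ p → U.entry c.1 c.2 = T.entry c.1 c.2 := by
    intro c hc
    by_cases hcc : c ∈ T.cells
    · rw [← hs.2.1 c] at hcc
      have a1 : ∀ c ∈ l₁, U.entry c.1 c.2 = T.entry c.1 c.2 :=
        List.map_inj_left.1 (hU.1.trans hl₁.symm)
      have a2 : ∀ c ∈ l₂, U.entry c.1 c.2 = T.entry c.1 c.2 :=
        List.map_inj_left.1 (hU.2.2.trans hl₂.symm)
      simp only [List.mem_append, List.mem_cons, hc, false_or] at hcc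
      exact hcc.elim (a1 c) (a2 c)
    · rw [mem_cells_iff] at hcc
      rw [T.entry_eq_zero c.1 c.2 hcc, U.entry_eq_zero c.1 c.2 (by rwa [hout, hin])]
  have hpc : p ∈ T.cells := by rw [← hs.2.1 p]; simp
  have hpT := (mem_cells_and_entry_iff T (i + 1) p).1 ⟨hpc, hp⟩
  have hpU := (mem_cells_and_entry_iff U i p).1 ⟨by rwa [mem_cells_iff, hout, hin, ← mem_cells_iff],
    hU.2.1⟩
  have hpat : ∀ k r j, (r, j) ≠ p → (j < U.pat k r ↔ j < T.pat k r) := by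
    intro k r j hne
    rw [lt_pat_iff, lt_pat_iff, hout, hin, heq (r, j) hne]
  obtain ⟨r, q⟩ := p
  simp only at hpT hpU hp hU
  obtain ⟨hq1, hq2⟩ := hpT
  -- The changed letter is the leftmost `i + 1` of its row, since otherwise `U` would have an `i +
  -- 1` to the left of an `i`.
  have hq : q = T.pat (i + 1) r := by
    by_contra hne
    have := hpat (i + 1) r (T.pat (i + 1) r) (by simpa using fun h => hne h.symm)
    omega
  refine ⟨r, ?_, ?_⟩
  · have hheight : height T.pat i r = excess i u - 1 := by
      rw [← hl₁]; exact height_eq_of_append hs hq (by simpa [← hq] using hq2)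
    -- Rows without letters `i + 1` correspond to no letter of the word, but the height does not
    -- drop there, so the comparison reduces to the rows that have one.
    have hflat : ∀ t, T.pat (i + 1) t = T.pat (i + 2) t →
        (t = 0 ∧ height T.pat i t = 0) ∨
        ∃ t', t = t' + 1 ∧ height T.pat i t' ≤ height T.pat i t := by
      intro t ht
      rcases t with _ | t
      · exact Or.inl ⟨rfl, by rw [height_zero, ht]; ring⟩
      · have := height_succ T.pat i t
        have := hT.mono i t
        exact Or.inr ⟨t, rfl, by lia⟩
    have hdiff : ∀ t, T.pat (i + 1) t < T.pat (i + 2) t →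
        (t, T.pat (i + 1) t) ∈ l₁ ++ (r, q) :: l₂ := by
      intro t ht
      rw [hs.2.1]
      exact ((mem_cells_and_entry_iff T (i + 1) (t, T.pat (i + 1) t)).2 ⟨le_rfl, ht⟩).1
    have hpw := hs.2.2
    rw [List.pairwise_append, List.pairwise_cons] at hpw
    obtain ⟨-, ⟨hpw2, -⟩, hpw1⟩ := hpw
    have hneg : height T.pat i r < 0 := by
      have := hu u List.suffix_rfl
      rw [hheight, excess]; omega
    have hbefore : ∀ t, t < r → T.pat (i + 1) t < T.pat (i + 2) t →
        height T.pat i r < height T.pat i t := by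
      intro t ht hb
      have hmem1 : (t, T.pat (i + 1) t) ∈ l₁ := by
        refine (List.mem_append.1 (hdiff t hb)).resolve_right fun h => ?_
        rcases List.mem_cons.1 h with h | h
        · simp only [Prod.mk.injEq] at h; omega
        · refine hpw2 _ h ⟨ht.le, ?_⟩
          rw [hq]; exact hT.antitone _ ht.le
      obtain ⟨m, m', rfl⟩ := List.append_of_mem hmem1
      rw [List.append_assoc] at hs
      have e1 := height_eq_of_append hs rfl hb
      have e2 := ((mem_cells_and_entry_iff T (i + 1) (t, T.pat (i + 1) t)).2 ⟨le_rfl, hb⟩).2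
      simp only at e1 e2
      rw [readWord_append, readWord_cons, e2] at hl₁
      have e3 := hu (T.readWord m') ⟨T.readWord m ++ [i + 1], by rw [← hl₁]; simp⟩
      have e4 : excess i (T.readWord m') ≤ 0 := by unfold excess; omega
      rw [hheight, ← hl₁, excess_append, excess_cons_succ]
      omega
    have hafter : ∀ t, r < t → T.pat (i + 1) t < T.pat (i + 2) t →
        height T.pat i r ≤ height T.pat i t := by
      intro t ht hb
      have hmem2 : (t, T.pat (i + 1) t) ∈ l₂ := by
        rcases List.mem_append.1 (hdiff t hb) with h | h
        · refine absurd ⟨ht.le, ?_⟩ (hpw1 _ h _ List.mem_cons_self)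
          rw [hq]; exact hT.antitone _ ht.le
        · refine (List.mem_cons.1 h).resolve_left fun h => ?_
          simp only [Prod.mk.injEq] at h; omega
      obtain ⟨m, m', rfl⟩ := List.append_of_mem hmem2
      rw [← List.cons_append, ← List.append_assoc] at hs
      have e1 := height_eq_of_append hs rfl hb
      have e2 := ((mem_cells_and_entry_iff T (i + 1) (t, T.pat (i + 1) t)).2 ⟨le_rfl, hb⟩).2
      simp only at e1 e2
      rw [readWord_append, readWord_cons, e2] at hl₂
      have e3 := hv (T.readWord m ++ [i + 1]) ⟨T.readWord m', by rw [← hl₂]; simp⟩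
      have e4 : 0 ≤ excess i (T.readWord m ++ [i + 1]) := by unfold excess; omega
      rw [excess_append, excess_cons_succ, excess_nil] at e4
      rw [readWord_append, readWord_cons, hp, excess_append, excess_cons_succ] at e1
      have e5 : excess i (T.readWord l₁) = excess i u := congrArg _ hl₁
      omega
    refine ⟨hneg, fun t ht => ?_, fun t ht => ?_⟩
    · induction t with
      | zero =>
        rcases (hT.mono (i + 1) 0).eq_or_lt with h0 | h0
        · rcases hflat 0 h0 with h | ⟨t', h, -⟩
          · rw [h.2]; exact hneg
          · omega
        · exact hbefore 0 ht h0
      | succ t ih =>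
        rcases (hT.mono (i + 1) (t + 1)).eq_or_lt with h0 | h0
        · rcases hflat (t + 1) h0 with h | ⟨t', h, h'⟩
          · omega
          · obtain rfl : t = t' := by omega
            exact (ih (by omega)).trans_le h'
        · exact hbefore _ ht h0
    · induction t, ht using Nat.le_induction with
      | base => exact le_rfl
      | succ t ht ih =>
        rcases (hT.mono (i + 1) (t + 1)).eq_or_lt with h0 | h0
        · rcases hflat (t + 1) h0 with h | ⟨t', h, h'⟩
          · omega
          · obtain rfl : t = t' := by omega
            exact ih.trans h'
        · exact hafter _ (by omega) h0
  · funext k t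
    refine eq_of_forall_lt_iff fun j => ?_
    unfold raiseAt
    by_cases hne : (t, j) = (r, q)
    · simp only [Prod.mk.injEq] at hne
      obtain ⟨rfl, rfl⟩ := hne
      have mT := fun {k l : ℕ} (h : k ≤ l) => hT.mono_le h t
      have mU := fun {k l : ℕ} (h : k ≤ l) => U.isPattern_pat.mono_le h t
      rcases lt_trichotomy k (i + 1) with hk | rfl | hk
      · have := mT (show k ≤ i + 1 by omega)
        have := mU (show k ≤ i by omega)
        rw [if_neg (by omega)]
        omega
      · rw [if_pos ⟨rfl, rfl⟩]
        omega
      · have := mT (show i + 1 + 1 ≤ k by omega)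
        have := mU (show i + 1 ≤ k by omega)
        rw [if_neg (by omega)]
        omega
    · rw [hpat k t j hne]
      split
      · next h =>
        obtain ⟨rfl, rfl⟩ := h
        have : j ≠ q := fun h => hne (by rw [h])
        omega
      · rfl

/-! ### The row reading order -/

/-- The squares of `T`, listed by rows from top to bottom, each row from right to left. -/
def rowCells (T : SkewSSYT) : List (ℕ × ℕ) :=
  (List.range (T.outer.colLen 0)).flatMap fun i =>
    (List.range' (T.inner.rowLen i) (T.outer.rowLen i - T.inner.rowLen i)).reverse.map (Prod.mk i)

theorem readWord_rowCells (T : SkewSSYT) : T.readWord T.rowCells = T.rowWord := by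
  simp [readWord, rowCells, rowWord, List.map_flatMap, Function.comp_def]

theorem mem_rowCells (T : SkewSSYT) (c : ℕ × ℕ) : c ∈ T.rowCells ↔ c ∈ T.cells := by
  obtain ⟨r, j⟩ := c
  rw [mem_cells_iff]
  simp only [rowCells, List.mem_flatMap, List.mem_range, List.mem_map, List.mem_reverse,
    List.mem_range'_1, Prod.mk.injEq, YoungDiagram.mem_iff_lt_rowLen]
  constructor
  · rintro ⟨s, hs, m, hm, rfl, rfl⟩
    omega
  · rintro ⟨h1, h2⟩
    refine ⟨r, ?_, j, by omega, rfl, rfl⟩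
    rw [← YoungDiagram.mem_iff_lt_colLen]
    exact T.outer.up_left_mem le_rfl (Nat.zero_le j) (YoungDiagram.mem_iff_lt_rowLen.2 h1)

theorem pairwise_rowCells (T : SkewSSYT) :
    T.rowCells.Pairwise fun a b => a.1 < b.1 ∨ (a.1 = b.1 ∧ b.2 < a.2) := by
  unfold rowCells
  rw [List.pairwise_flatMap]
  constructor
  · intro i _
    rw [List.pairwise_map, List.pairwise_reverse]
    exact (List.pairwise_lt_range' 1 (by simp)).imp fun h => Or.inr ⟨rfl, h⟩
  · refine List.pairwise_lt_range.imp fun h => ?_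
    simp only [List.mem_map]
    rintro _ ⟨a, _, rfl⟩ _ ⟨b, _, rfl⟩
    exact Or.inl h

theorem nodup_rowCells (T : SkewSSYT) : T.rowCells.Nodup :=
  T.pairwise_rowCells.imp fun {a b} h => by
    rintro rfl
    omega

theorem isReadingOrder_rowCells (T : SkewSSYT) : T.IsReadingOrder T.rowCells :=
  ⟨T.nodup_rowCells, T.mem_rowCells, T.pairwise_rowCells.imp fun h => by omega⟩

/-- A lower bound for the excess of an initial part of the row reading word that ends with a letter
`i + 1`. -/
theorem height_le_excess {T : SkewSSYT} {i : ℕ} {l l' : List (ℕ × ℕ)} {c : ℕ × ℕ}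
    (hs : T.rowCells = l ++ c :: l') (hc : T.entry c.1 c.2 = i + 1) :
    height T.pat i c.1 + (if (c.1, T.pat (i + 1) c.1) ∈ l ++ [c] then 0 else 1) ≤
      excess i (T.readWord (l ++ [c])) := by
  have hT := T.isPattern_pat
  have hpw := T.pairwise_rowCells
  have hnd := T.nodup_rowCells
  have hmem := T.mem_rowCells
  rw [hs, List.append_cons] at hpw hnd hmem
  have hmem' : ∀ a ∈ l ++ [c], a ∈ T.cells := fun a ha =>
    (hmem a).1 (List.mem_append_left _ ha)
  have hnd' := (List.nodup_append.1 hnd).1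
  rw [List.pairwise_append] at hpw
  obtain ⟨hpw1, -, hpw2⟩ := hpw
  rw [List.pairwise_append] at hpw1
  have hrow : ∀ a ∈ l ++ [c], a.1 ≤ c.1 := by
    intro a ha
    rcases List.mem_append.1 ha with h | h
    · have := hpw1.2.2 a h c (by simp)
      omega
    · rw [List.mem_singleton.1 h]
  have hrow' : ∀ a ∈ T.cells, a.1 < c.1 → a ∈ l ++ [c] := by
    intro a ha hlt
    refine (List.mem_append.1 ((hmem a).2 ha)).resolve_right fun h => ?_
    have := hpw2 c (by simp) a h
    omega
  rw [height_pat, excess, count_readWord T hnd', count_readWord T hnd']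
  have h1 : (T.lettersAbove i c.1).card ≤
      ((l ++ [c]).toFinset.filter fun a => T.entry a.1 a.2 = i).card := by
    refine Finset.card_le_card fun a ha => ?_
    rw [mem_lettersAbove] at ha
    rw [Finset.mem_filter, List.mem_toFinset]
    exact ⟨hrow' a ha.2.1 ha.1, ha.2.2⟩
  have h2 : ((l ++ [c]).toFinset.filter fun a => T.entry a.1 a.2 = i + 1) ⊆
      T.lettersAbove (i + 1) (c.1 + 1) := by
    intro a ha
    rw [Finset.mem_filter, List.mem_toFinset] at ha
    rw [mem_lettersAbove]
    exact ⟨Nat.lt_succ_of_le (hrow a ha.1), hmem' a ha.1, ha.2⟩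
  have h3 : ((l ++ [c]).toFinset.filter fun a => T.entry a.1 a.2 = i + 1).card +
      (if (c.1, T.pat (i + 1) c.1) ∈ l ++ [c] then 0 else 1) ≤
      (T.lettersAbove (i + 1) (c.1 + 1)).card := by
    split_ifs with hq
    · exact Finset.card_le_card h2
    · refine Finset.card_lt_card (Finset.ssubset_iff_subset_ne.2 ⟨h2, fun he => hq ?_⟩)
      have hcc := (mem_cells_and_entry_iff T (i + 1) c).1 ⟨hmem' c (by simp), hc⟩
      have hqq := (mem_cells_and_entry_iff T (i + 1) (c.1, T.pat (i + 1) c.1)).2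
        ⟨le_rfl, hcc.1.trans_lt hcc.2⟩
      have : (c.1, T.pat (i + 1) c.1) ∈ T.lettersAbove (i + 1) (c.1 + 1) := by
        rw [mem_lettersAbove]
        exact ⟨Nat.lt_succ_self _, hqq⟩
      rw [← he, Finset.mem_filter, List.mem_toFinset] at this
      exact this.1
  split_ifs at h3 ⊢ <;> omega

/-- A lower bound for the excess of an initial part of the row reading word. -/
theorem le_excess_of_prefix {T : SkewSSYT} {i : ℕ} {b : ℤ} (hb : b ≤ 0) (l l' : List (ℕ × ℕ))
    (hs : T.rowCells = l ++ l')
    (h : ∀ c ∈ l, T.entry c.1 c.2 = i + 1 →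
      b ≤ height T.pat i c.1 + (if (c.1, T.pat (i + 1) c.1) ∈ l then 0 else 1)) :
    b ≤ excess i (T.readWord l) := by
  induction l using List.reverseRecOn generalizing l' with
  | nil => exact hb
  | append_singleton l c ih =>
    rw [List.append_assoc, List.singleton_append] at hs
    by_cases hc : T.entry c.1 c.2 = i + 1
    · exact (h c (by simp) hc).trans (height_le_excess hs hc)
    · have e : excess i (T.readWord l) ≤ excess i (T.readWord (l ++ [c])) := by
        rw [readWord_append, excess_append]
        have := excess_cons_of_ne hc []
        rw [excess_nil] at this
        exact le_add_of_nonneg_right this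
      refine (ih _ hs fun a ha hae => ?_).trans e
      have := h a (by simp [ha]) hae
      refine this.trans ?_
      simp only [List.mem_append]
      split_ifs with h1 h2 h2 <;> first | omega | tauto

/-- The excess is smallest after prefixes ending with the leftmost `i + 1` of a row, where it equals
the height. -/
theorem isLittlewoodRichardson_iff (T : SkewSSYT) :
    T.IsLittlewoodRichardson ↔ ∀ i r, 0 ≤ height T.pat i r := by
  constructor
  · intro h i r
    by_contra! hneg
    -- The given row may contain no `i + 1`; the row of the first minimum does, so its height is the
    -- excess of an actual prefix.
    obtain ⟨p, hp⟩ := T.isPattern_pat.exists_isRaiseRow ⟨r, hneg⟩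
    have hlt := (T.isPattern_pat.raiseAt_lt hp).1
    have hq := (mem_cells_and_entry_iff T (i + 1) (p, T.pat (i + 1) p)).2 ⟨le_rfl, hlt⟩
    rw [← mem_rowCells] at hq
    obtain ⟨l, l', hl⟩ := List.append_of_mem hq.1
    have e1 := height_eq_of_append (hl ▸ T.isReadingOrder_rowCells) rfl hlt
    have e2 := h (T.readWord l ++ [i + 1]) ⟨T.readWord l', by
      rw [← readWord_rowCells, hl, readWord_append, readWord_cons, hq.2]; simp⟩ i
    have e3 : 0 ≤ excess i (T.readWord l ++ [i + 1]) := by unfold excess; omega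
    rw [excess_append, excess_cons_succ, excess_nil] at e3
    have := hp.1
    simp only at e1
    omega
  · rintro h u ⟨v, hu⟩ i
    rw [← readWord_rowCells] at hu
    obtain ⟨l, l', hl, rfl, -⟩ := List.map_eq_append_iff.1 hu.symm
    have : 0 ≤ excess i (T.readWord l) := by
      refine le_excess_of_prefix le_rfl l l' hl fun c _ _ => ?_
      have := h i c.1
      split_ifs <;> omega
    unfold excess at this
    change (T.readWord l).count (i + 1) ≤ (T.readWord l).count i
    omega

theorem raises_iff {i : ℕ} {T U : SkewSSYT} : Raises i T U ↔ RaisesPattern i T.pat U.pat := by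
  refine ⟨Raises.raisesPattern, ?_⟩
  rintro ⟨r, hr, hU⟩
  have hT := T.isPattern_pat
  have hlt := (hT.raiseAt_lt hr).1
  have hmem : ∀ k s j, (s, j) ≠ (r, T.pat (i + 1) r) → (j < U.pat k s ↔ j < T.pat k s) := by
    intro k s j hne
    rw [hU]
    unfold raiseAt
    split
    · next h =>
      obtain ⟨rfl, rfl⟩ := h
      have : j ≠ T.pat (i + 1) s := fun h => hne (by rw [h])
      omega
    · rfl
  have hUi : U.entry r (T.pat (i + 1) r) = i := by
    apply entry_eq_of_lt_of_le
    · rw [hU, raiseAt_level (by omega)]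
      exact hT.mono i r
    · rw [hU, raiseAt_same]; omega
  have hTi := (mem_cells_and_entry_iff T (i + 1) (r, T.pat (i + 1) r)).2 ⟨le_rfl, hlt⟩
  have heq : ∀ c, c ≠ (r, T.pat (i + 1) r) → U.entry c.1 c.2 = T.entry c.1 c.2 := fun c hc =>
    entry_congr fun k => hmem k c.1 c.2 hc
  have hin : U.inner = T.inner := by
    ext ⟨s, j⟩
    rw [YoungDiagram.mem_cells, YoungDiagram.mem_cells, ← lt_pat_zero_iff, ← lt_pat_zero_iff, hU,
      raiseAt_level (by omega)]
  have hout : U.outer = T.outer := by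
    ext ⟨s, j⟩
    rw [YoungDiagram.mem_cells, YoungDiagram.mem_cells]
    by_cases hc : (s, j) = (r, T.pat (i + 1) r)
    · simp only [Prod.mk.injEq] at hc
      obtain ⟨rfl, rfl⟩ := hc
      refine iff_of_true ((mem_outer_iff _ _ _).2 ⟨i + 2, ?_⟩) ((mem_outer_iff _ _ _).2 ⟨i + 2, hlt⟩)
      rw [hU, raiseAt_level (by omega)]; exact hlt
    · rw [mem_outer_iff, mem_outer_iff]
      simp only [hmem _ s j hc]
  refine ⟨hout, hin, T.rowCells, T.isReadingOrder_rowCells, ?_⟩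
  obtain ⟨l₁, l₂, hl⟩ := List.append_of_mem ((T.mem_rowCells _).2 hTi.1)
  have hnd := T.nodup_rowCells
  have hpw := T.pairwise_rowCells
  have hh := height_eq_of_append (hl ▸ T.isReadingOrder_rowCells) rfl hlt
  simp only at hh
  have hneg := hr.1
  rw [hl] at hnd hpw
  have hnot : (r, T.pat (i + 1) r) ∉ l₁ ∧ (r, T.pat (i + 1) r) ∉ l₂ := by
    rw [List.nodup_append, List.nodup_cons] at hnd
    exact ⟨fun h => hnd.2.2 _ h _ List.mem_cons_self rfl, hnd.2.1.1⟩
  have hword : ∀ l : List (ℕ × ℕ), (r, T.pat (i + 1) r) ∉ l → U.readWord l = T.readWord l :=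
    fun l h => List.map_congr_left fun c hc => heq c fun e => h (e ▸ hc)
  refine ⟨T.readWord l₁, T.readWord l₂, ?_, ?_, ?_, ?_⟩
  · rw [hl, readWord_append, readWord_cons, hTi.2]
  · rw [hl, readWord_append, readWord_cons, hUi, hword l₁ hnot.1, hword l₂ hnot.2]
  · rintro w ⟨v, hw⟩
    obtain ⟨m, m', rfl, rfl, rfl⟩ := List.map_eq_append_iff.1 hw.symm
    -- The right side of the bound for `m` is the excess of all of `l₁`, so the remaining suffix has
    -- excess at most 0. Rows before `r` have a strictly larger height, and within row `r` the
    -- leftmost `i + 1` has not been read yet; either fact supplies the extra 1.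
    have key : height T.pat i r + 1 ≤ excess i (T.readWord m) := by
      refine le_excess_of_prefix (by omega) m (m' ++ (r, T.pat (i + 1) r) :: l₂)
        (by rw [hl, List.append_assoc]) fun c hc _ => ?_
      rw [List.pairwise_append] at hpw
      have hcr := hpw.2.2 c (List.mem_append_left _ hc) _ List.mem_cons_self
      simp only at hcr
      rcases lt_or_ge c.1 r with h | h
      · have := hr.2.1 c.1 h
        split_ifs <;> omega
      · have hcr' : c.1 = r := by omega
        rw [hcr', if_neg fun h => hnot.1 (List.mem_append_left _ h)]
    have : excess i (T.readWord (m ++ m')) = excess i (T.readWord m) + excess i (T.readWord m') := by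
      rw [readWord_append, excess_append]
    have : excess i (T.readWord m') ≤ 0 := by omega
    unfold excess at this
    change (T.readWord m').count i ≤ (T.readWord m').count (i + 1)
    omega
  · rintro w ⟨v, hw⟩
    obtain ⟨m, m', rfl, rfl, rfl⟩ := List.map_eq_append_iff.1 hw.symm
    -- The height at `r` is the excess just after the changed letter, so this bound makes the excess
    -- of `m` nonnegative.
    have key : height T.pat i r ≤ excess i (T.readWord (l₁ ++ (r, T.pat (i + 1) r) :: m)) := by
      refine le_excess_of_prefix hneg.le _ m' (by rw [hl]; simp) fun c _ _ => ?_
      have : height T.pat i r ≤ height T.pat i c.1 := by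
        rcases lt_or_ge c.1 r with h | h
        · exact (hr.2.1 c.1 h).le
        · exact hr.2.2 c.1 h
      split_ifs <;> omega
    rw [readWord_append, readWord_cons, hTi.2, excess_append, excess_cons_succ] at key
    have : 0 ≤ excess i (T.readWord m) := by omega
    unfold excess at this
    change (T.readWord m).count (i + 1) ≤ (T.readWord m).count i
    omega

end SkewSSYT

/-! ### Rewrite systems with labelled steps -/

section Rewriting

variable {α ι : Type*}

/-- `b` is obtained from `a` by successive steps with the labels in the given list. -/
def Steps (S : ι → α → α → Prop) : List ι → α → α → Prop
  | [], a, b => a = b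
  | x :: l, a, b => ∃ c, S x a c ∧ Steps S l c b

theorem reflTransGen_iff_steps {S : ι → α → α → Prop} {r : α → α → Prop}
    (hr : ∀ a b, r a b ↔ ∃ x, S x a b) {a b : α} :
    Relation.ReflTransGen r a b ↔ ∃ l, Steps S l a b := by
  constructor
  · intro h
    induction h using Relation.ReflTransGen.head_induction_on with
    | refl => exact ⟨[], rfl⟩
    | head h _ ih =>
      obtain ⟨x, hx⟩ := (hr _ _).1 h
      obtain ⟨l, hl⟩ := ih
      exact ⟨x :: l, _, hx, hl⟩
  · rintro ⟨l, hl⟩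
    induction l generalizing a with
    | nil => exact hl ▸ Relation.ReflTransGen.refl
    | cons x l ih =>
      obtain ⟨c, hx, hc⟩ := hl
      exact Relation.ReflTransGen.head ((hr _ _).2 ⟨x, hx⟩) (ih hc)

theorem Steps.injective {S : ι → α → α → Prop} (hS : ∀ x a b c, S x a c → S x b c → a = b)
    {l : List ι} {a b c : α} (ha : Steps S l a c) (hb : Steps S l b c) : a = b := by
  induction l generalizing a b with
  | nil => exact Eq.trans ha (Eq.symm hb)
  | cons x l ih =>
    obtain ⟨a', hxa, ha⟩ := ha
    obtain ⟨b', hxb, hb⟩ := hb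
    obtain rfl := ih ha hb
    exact hS _ _ _ _ hxa hxb

theorem Steps.commute {S : ι → α → α → Prop} {R : α → α → Prop}
    (h : ∀ x a b c, S x a b → R a c → ∃ d, S x c d ∧ R b d) {l : List ι} {a b c : α}
    (hab : Steps S l a b) (hac : R a c) : ∃ d, Steps S l c d ∧ R b d := by
  induction l generalizing a c with
  | nil =>
    obtain rfl : a = b := hab
    exact ⟨c, rfl, hac⟩
  | cons x l ih =>
    obtain ⟨a', hx, ha'⟩ := hab
    obtain ⟨c', hc, hac'⟩ := h x a a' c hx hac
    obtain ⟨d, hd, hbd⟩ := ih ha' hac'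
    exact ⟨d, ⟨c', hc, hd⟩, hbd⟩

theorem exists_isNormalFormOf {r : α → α → Prop} (f : α → ℕ) (hf : ∀ a b, r a b → f b < f a)
    (a : α) : ∃ b, IsNormalFormOf r b a := by
  induction hn : f a using Nat.strong_induction_on generalizing a with
  | _ n ih =>
    by_cases h : IsNormal r a
    · exact ⟨a, Relation.ReflTransGen.refl, h⟩
    · unfold IsNormal at h
      push Not at h
      obtain ⟨b, hb⟩ := h
      obtain ⟨c, hc, hn⟩ := ih (f b) (hn ▸ hf a b hb) b rfl
      exact ⟨c, Relation.ReflTransGen.head hb hc, hn⟩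

theorem confluent_of_normalForm {r : α → α → Prop} (he : ∀ a, ∃ b, IsNormalFormOf r b a)
    (hu : ∀ a b c, IsNormalFormOf r b a → IsNormalFormOf r c a → b = c) : Confluent r := by
  intro a b c hb hc
  obtain ⟨b', hb', hbn⟩ := he b
  obtain ⟨c', hc', hcn⟩ := he c
  obtain rfl := hu a b' c' ⟨hb.trans hb', hbn⟩ ⟨hc.trans hc', hcn⟩
  exact ⟨b', hb', hc'⟩

end Rewriting

namespace SkewSSYT

/-! ### Slides and raising operations as commuting systems of labelled steps -/

/-- A slide, labelled by the row of the inner shape into which it goes and by the outer shape. -/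
def LabelledSlide (x : ℕ × YoungDiagram) (T T' : SkewSSYT) : Prop :=
  T.outer = x.2 ∧ PatSlide x.1 T T'

theorem inwardSlide_iff_labelledSlide (T T' : SkewSSYT) :
    InwardSlide T T' ↔ ∃ x, LabelledSlide x T T' := by
  rw [inwardSlide_iff]
  exact ⟨fun ⟨r, h⟩ => ⟨(r, T.outer), rfl, h⟩, fun ⟨x, h⟩ => ⟨x.1, h.2⟩⟩

/-- The outer shape in the label makes the two chains agree at large levels, which is where undoing
a slide starts. -/
theorem LabelledSlide.injective (x : ℕ × YoungDiagram) (T U V : SkewSSYT)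
    (h : LabelledSlide x T V) (h' : LabelledSlide x U V) : T = U := by
  refine ext_of_pat (slidePattern_injective T.isPattern_pat U.isPattern_pat h.2.1 h'.2.1
    (h.2.2.symm.trans h'.2.2) ?_)
  obtain ⟨N, hN⟩ := T.exists_entry_bound
  obtain ⟨N', hN'⟩ := U.exists_entry_bound
  refine ⟨max N N', fun k hk => ?_⟩
  funext r
  rw [pat_eq_outer hN (by omega), pat_eq_outer hN' (by omega), h.1, h'.1]

theorem Raises.injective (i : ℕ) (T U V : SkewSSYT) (h : Raises i T V) (h' : Raises i U V) :
    T = U :=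
  ext_of_pat (h.raisesPattern.injective h'.raisesPattern)

theorem Raises.pat_zero {i : ℕ} {T U : SkewSSYT} (h : Raises i T U) : U.pat 0 = T.pat 0 := by
  funext r
  rw [SkewSSYT.pat_zero, SkewSSYT.pat_zero, h.2.1]

theorem LabelledSlide.commute (x : ℕ × YoungDiagram) {i : ℕ} {T T' U : SkewSSYT}
    (h : LabelledSlide x T T') (hU : Raises i T U) :
    ∃ U', LabelledSlide x U U' ∧ Raises i T' U' := by
  have hc : U.pat 0 (x.1 + 1) < U.pat 0 x.1 := by rw [hU.pat_zero]; exact h.2.1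
  obtain ⟨U', hU'⟩ := PatSlide.exists_of_corner hc
  refine ⟨U', ⟨hU.1.trans h.1, hU'⟩, ?_⟩
  rw [raises_iff, h.2.2, hU'.2]
  exact hU.raisesPattern.slide T.isPattern_pat h.2.1

/-- Raising changes neither shape, so the slide with the same label exists on `T`; by commutation it
lands above `U'`. -/
theorem LabelledSlide.lift (x : ℕ × YoungDiagram) {i : ℕ} {T U U' : SkewSSYT}
    (h : LabelledSlide x U U') (hU : Raises i T U) :
    ∃ T', LabelledSlide x T T' ∧ Raises i T' U' := by
  have hc : T.pat 0 (x.1 + 1) < T.pat 0 x.1 := by rw [← hU.pat_zero]; exact h.2.1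
  obtain ⟨T', hT'⟩ := PatSlide.exists_of_corner hc
  have hTx : LabelledSlide x T T' := ⟨hU.1.symm.trans h.1, hT'⟩
  obtain ⟨U'', hU'', hr⟩ := hTx.commute x hU
  exact ⟨T', hTx, (h.2.unique hU''.2).symm ▸ hr⟩

/-- The elementary commuting squares are pasted into a rectangle. Both label lists are kept, which
is what allows opposite sides to be undone later. -/
theorem Steps.commute_raises {l : List (ℕ × YoungDiagram)} {m : List ℕ} {T P L : SkewSSYT}
    (hP : Steps LabelledSlide l T P) (hL : Steps Raises m T L) :
    ∃ Q, Steps LabelledSlide l L Q ∧ Steps Raises m P Q := by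
  obtain ⟨Q, h1, h2⟩ := Steps.commute (S := Raises) (R := Steps LabelledSlide l)
    (fun i _ _ _ hab hac => (Steps.commute (R := Raises i)
      (fun x _ _ _ h h' => LabelledSlide.commute x h h') hac hab).imp fun _ h => h.symm) hL hP
  exact ⟨Q, h2, h1⟩

theorem Steps.lift_raises {l : List (ℕ × YoungDiagram)} {m : List ℕ} {T L Q : SkewSSYT}
    (hL : Steps Raises m T L) (hQ : Steps LabelledSlide l L Q) :
    ∃ P, Steps LabelledSlide l T P ∧ Steps Raises m P Q := by
  induction m generalizing T with
  | nil =>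
    obtain rfl : T = L := hL
    exact ⟨Q, hQ, rfl⟩
  | cons i m ih =>
    obtain ⟨U, hU, hL⟩ := hL
    obtain ⟨V, hV, hVQ⟩ := ih hL
    obtain ⟨P, hP, hPV⟩ := Steps.commute (R := fun A B => Raises i B A)
      (fun x _ _ _ h h' => LabelledSlide.lift x h h') hV hU
    exact ⟨P, hP, V, hPV, hVQ⟩

theorem Steps.inner_eq {m : List ℕ} {T L : SkewSSYT} (h : Steps Raises m T L) :
    L.inner = T.inner ∧ L.outer = T.outer := by
  induction m generalizing T with
  | nil => exact Eq.subst (motive := fun L => L.inner = T.inner ∧ L.outer = T.outer) h ⟨rfl, rfl⟩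
  | cons i m ih =>
    obtain ⟨U, hU, hL⟩ := h
    exact ⟨(ih hL).1.trans hU.2.1, (ih hL).2.trans hU.1⟩

theorem Steps.isLittlewoodRichardson {l : List (ℕ × YoungDiagram)} {T P : SkewSSYT}
    (h : Steps LabelledSlide l T P) (hT : T.IsLittlewoodRichardson) :
    P.IsLittlewoodRichardson := by
  induction l generalizing T with
  | nil => exact Eq.subst h hT
  | cons x l ih =>
    obtain ⟨U, hU, hP⟩ := h
    refine ih hP ?_
    rw [isLittlewoodRichardson_iff] at hT ⊢
    intro i r
    by_contra! hneg
    rw [hU.2.2] at hneg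
    obtain ⟨s, hs⟩ := exists_height_neg_of_slidePattern T.isPattern_pat hU.2.1 ⟨r, hneg⟩
    exact absurd (hT i s) (not_le.2 hs)

/-! ### Normal forms -/

theorem isNormal_inwardSlide_iff (T : SkewSSYT) : IsNormal InwardSlide T ↔ T.IsYoung := by
  constructor
  · intro h
    by_contra hne
    have hcorner : ∀ r, T.pat 0 r ≤ T.pat 0 (r + 1) := by
      intro r
      by_contra! hlt
      obtain ⟨T', hT'⟩ := PatSlide.exists_of_corner hlt
      exact h T' hT'.inwardSlide
    obtain ⟨N, hN, hN'⟩ := T.isPattern_pat.bounded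
    apply hne
    unfold IsYoung
    ext ⟨r, j⟩
    simp only [YoungDiagram.cells_bot, Finset.notMem_empty, iff_false, YoungDiagram.mem_cells]
    rw [← lt_pat_zero_iff]
    -- Without corners the row lengths of the inner shape increase weakly, but they are eventually
    -- 0.
    have h1 := monotone_nat_of_le_succ hcorner (show r ≤ max r N by omega)
    have h2 := T.isPattern_pat.le_of_bound hN 0 (max r N)
    rw [hN' _ (by omega)] at h2
    omega
  · rintro h T' ⟨c, hc, -⟩
    rw [h] at hc
    exact YoungDiagram.notMem_bot c hc

theorem isNormal_raisingStep_iff (T : SkewSSYT) :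
    IsNormal RaisingStep T ↔ T.IsLittlewoodRichardson := by
  rw [isLittlewoodRichardson_iff]
  constructor
  · intro h i r
    by_contra! hneg
    obtain ⟨p, hp⟩ := T.isPattern_pat.exists_isRaiseRow ⟨r, hneg⟩
    obtain ⟨U, hU⟩ := exists_pat_eq (T.isPattern_pat.raiseAt hp)
    exact h U ⟨i, raises_iff.2 ⟨p, hp, hU⟩⟩
  · rintro h U ⟨i, hU⟩
    obtain ⟨p, hp, -⟩ := hU.raisesPattern
    exact absurd (h i p) (not_le.2 hp.1)

theorem exists_normalForm_inwardSlide (T : SkewSSYT) : ∃ P, IsNormalFormOf InwardSlide P T := by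
  refine exists_isNormalFormOf (fun T => T.inner.cells.card) ?_ T
  rintro T T' ⟨c, hc, d, -, hin, -⟩
  simp only [hin]
  exact Finset.card_erase_lt_of_mem hc

theorem exists_normalForm_raisingStep (T : SkewSSYT) : ∃ L, IsNormalFormOf RaisingStep L T := by
  -- Each raising step lowers the sum of the entries by 1.
  refine exists_isNormalFormOf (fun T => ∑ c ∈ T.cells, T.entry c.1 c.2) ?_ T
  rintro T U ⟨i, hout, hin, s, hs, u, v, hu, hv, -⟩
  have hcells : U.cells = T.cells := by rw [cells, cells, hout, hin]
  have hset : s.toFinset = T.cells := by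
    ext c; rw [List.mem_toFinset, hs.2.1]
  have e1 := List.sum_toFinset (fun c : ℕ × ℕ => T.entry c.1 c.2) hs.1
  have e2 := List.sum_toFinset (fun c : ℕ × ℕ => U.entry c.1 c.2) hs.1
  rw [hset] at e1 e2
  change _ = (T.readWord s).sum at e1
  change _ = (U.readWord s).sum at e2
  simp only [hcells]
  rw [e1, e2, hu, hv]
  simp

/-! ### Littlewood-Richardson tableaux of partition shape -/

/-- Every entry of row `r` is `r`: entries are at least `r` by column strictness, and at most `r` by
the lattice condition. -/
theorem pat_of_isYoung_of_isLittlewoodRichardson {T : SkewSSYT} (hY : T.IsYoung)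
    (hL : T.IsLittlewoodRichardson) (k r : ℕ) :
    T.pat k r = if r < k then T.outer.rowLen r else 0 := by
  have hT := T.isPattern_pat
  have hzero : ∀ k r, k ≤ r → T.pat k r = 0 := by
    intro k
    induction k with
    | zero =>
      intro r _
      by_contra h
      have := (T.lt_pat_zero_iff r 0).1 (Nat.pos_of_ne_zero h)
      rw [hY] at this
      exact YoungDiagram.notMem_bot _ this
    | succ k ih =>
      intro r hr
      obtain ⟨r, rfl⟩ : ∃ s, r = s + 1 := ⟨r - 1, by omega⟩
      have := hT.interlace k r
      rw [ih r (by omega)] at this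
      omega
  rw [isLittlewoodRichardson_iff] at hL
  -- Here `k = i + 1` with `r ≤ i`. By induction no row above `r` contains an `i`, so nonnegativity
  -- of the height at `r` leaves no `i + 1` in the rows up to `r`.
  have hconst : ∀ r k, r < k → T.pat (k + 1) r = T.pat k r := by
    intro r
    induction r using Nat.strong_induction_on with
    | _ r ih =>
      intro k hk
      obtain ⟨i, rfl⟩ : ∃ i, k = i + 1 := ⟨k - 1, by omega⟩
      have h0 := hL i r
      have h1 : ∑ s ∈ Finset.range r, ((T.pat (i + 1) s : ℤ) - T.pat i s) = 0 :=
        Finset.sum_eq_zero fun s hs => by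
          rw [Finset.mem_range] at hs
          rw [ih s hs i (by omega)]; ring
      have h2 : ((T.pat (i + 2) r : ℤ) - T.pat (i + 1) r) ≤
          ∑ s ∈ Finset.range (r + 1), ((T.pat (i + 2) s : ℤ) - T.pat (i + 1) s) :=
        Finset.single_le_sum (f := fun s => (T.pat (i + 2) s : ℤ) - T.pat (i + 1) s)
          (fun s _ => by have : T.pat (i + 1) s ≤ T.pat (i + 2) s := hT.mono (i + 1) s; omega) (by simp)
      rw [height, h1] at h0
      have : T.pat (i + 1) r ≤ T.pat (i + 2) r := hT.mono (i + 1) r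
      change T.pat (i + 2) r = _
      omega
  split
  · next h =>
    obtain ⟨N, hN⟩ := T.exists_entry_bound
    rw [← pat_eq_outer hN (le_max_left N k)]
    have : ∀ l, k ≤ l → T.pat l r = T.pat k r := by
      intro l hl
      induction l, hl using Nat.le_induction with
      | base => rfl
      | succ l hl ih => rw [hconst r l (by omega), ih]
    exact (this _ (le_max_right N k)).symm
  · next h => exact hzero k r (by omega)

theorem eq_of_outer_eq {P Q : SkewSSYT} (hP : P.IsYoung) (hP' : P.IsLittlewoodRichardson)
    (hQ : Q.IsYoung) (hQ' : Q.IsLittlewoodRichardson) (h : ∀ r, P.outer.rowLen r = Q.outer.rowLen r) :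
    P = Q := by
  refine ext_of_pat ?_
  funext k r
  rw [pat_of_isYoung_of_isLittlewoodRichardson hP hP',
    pat_of_isYoung_of_isLittlewoodRichardson hQ hQ', h]

/-- Each slide removes one square from each partition of the chain. -/
theorem sum_pat_of_reflTransGen {T P : SkewSSYT} (h : Relation.ReflTransGen InwardSlide T P) :
    ∃ c, ∀ n, (∀ k, T.pat k n = 0) → ∀ k,
      ∑ r ∈ Finset.range n, P.pat k r + c = ∑ r ∈ Finset.range n, T.pat k r := by
  induction h using Relation.ReflTransGen.head_induction_on with
  | refl => exact ⟨0, fun _ _ _ => rfl⟩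
  | @head T U h _ ih =>
    obtain ⟨c, hc⟩ := ih
    obtain ⟨s, hs⟩ := inwardSlide_iff.1 h
    refine ⟨c + 1, fun n hn k => ?_⟩
    have hn' : ∀ k, U.pat k n = 0 := fun k => by
      have := slidePattern_le T.pat s k n
      rw [← hs.2, hn k] at this
      omega
    have hcorner := slideRow_corner T.isPattern_pat hs.1 k
    have hlt : slideRow T.pat s k < n := by
      by_contra! hle
      have := T.isPattern_pat.antitone k hle
      rw [hn k] at this
      omega
    have hpt : ∀ r, T.pat k r = U.pat k r + if r = slideRow T.pat s k then 1 else 0 := by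
      intro r
      rw [hs.2]
      unfold slidePattern
      split
      · next h => subst h; omega
      · rfl
    rw [← add_assoc, hc n hn' k]
    simp only [hpt, Finset.sum_add_distrib, Finset.sum_ite_eq', Finset.mem_range, hlt, if_true]

theorem rowLen_outer_add_sum {P : SkewSSYT} (hP : P.IsYoung) (hP' : P.IsLittlewoodRichardson)
    {k n : ℕ} (hk : k < n) : ∑ r ∈ Finset.range n, P.pat (k + 1) r =
      ∑ r ∈ Finset.range n, P.pat k r + P.outer.rowLen k := by
  have hpt : ∀ r, P.pat (k + 1) r = P.pat k r + if r = k then P.outer.rowLen k else 0 := by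
    intro r
    rw [pat_of_isYoung_of_isLittlewoodRichardson hP hP',
      pat_of_isYoung_of_isLittlewoodRichardson hP hP']
    rcases lt_trichotomy r k with h | rfl | h
    · rw [if_pos (by omega), if_pos h, if_neg (by omega)]; rfl
    · simp
    · rw [if_neg (by omega), if_neg (by omega), if_neg (by omega)]
  simp only [hpt, Finset.sum_add_distrib, Finset.sum_ite_eq', Finset.mem_range, hk, if_true]

/-- Slides preserve the number of letters `k` for each `k`, and for `P` and `Q` this number is the
length of row `k`. -/
theorem eq_of_reflTransGen_inwardSlide {L P Q : SkewSSYT}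
    (hLP : Relation.ReflTransGen InwardSlide L P) (hLQ : Relation.ReflTransGen InwardSlide L Q)
    (hP : P.IsYoung) (hP' : P.IsLittlewoodRichardson) (hQ : Q.IsYoung)
    (hQ' : Q.IsLittlewoodRichardson) : P = Q := by
  refine eq_of_outer_eq hP hP' hQ hQ' fun r => ?_
  obtain ⟨N, hN, hN'⟩ := L.isPattern_pat.bounded
  have hn : ∀ k, L.pat k (N + r + 1) = 0 := fun k => by
    have := L.isPattern_pat.le_of_bound hN k (N + r + 1)
    rw [hN' _ (by omega)] at this
    omega
  obtain ⟨c, hc⟩ := sum_pat_of_reflTransGen hLP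
  obtain ⟨d, hd⟩ := sum_pat_of_reflTransGen hLQ
  have c1 := hc _ hn r
  have c2 := hc _ hn (r + 1)
  have d1 := hd _ hn r
  have d2 := hd _ hn (r + 1)
  have p := rowLen_outer_add_sum hP hP' (show r < N + r + 1 by omega)
  have q := rowLen_outer_add_sum hQ hQ' (show r < N + r + 1 by omega)
  omega

/-! ### Uniqueness of normal forms -/

theorem reflTransGen_inwardSlide_iff {T P : SkewSSYT} :
    Relation.ReflTransGen InwardSlide T P ↔ ∃ l, Steps LabelledSlide l T P :=
  reflTransGen_iff_steps inwardSlide_iff_labelledSlide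

theorem reflTransGen_raisingStep_iff {T L : SkewSSYT} :
    Relation.ReflTransGen RaisingStep T L ↔ ∃ m, Steps Raises m T L :=
  reflTransGen_iff_steps fun _ _ => Iff.rfl

/-- One list of raisings, from `T` to a Littlewood–Richardson tableau `L`, is transported to both
`P₁` and `P₂`. The ends coincide because they are slides of `L` that are Young and
Littlewood–Richardson; the common list is then undone. -/
theorem normalForm_inwardSlide_unique (T P₁ P₂ : SkewSSYT) (h₁ : IsNormalFormOf InwardSlide P₁ T)
    (h₂ : IsNormalFormOf InwardSlide P₂ T) : P₁ = P₂ := by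
  obtain ⟨L, hTL, hL⟩ := exists_normalForm_raisingStep T
  rw [isNormal_raisingStep_iff] at hL
  obtain ⟨m, hm⟩ := reflTransGen_raisingStep_iff.1 hTL
  obtain ⟨l₁, hl₁⟩ := reflTransGen_inwardSlide_iff.1 h₁.1
  obtain ⟨l₂, hl₂⟩ := reflTransGen_inwardSlide_iff.1 h₂.1
  obtain ⟨Q₁, hLQ₁, hPQ₁⟩ := Steps.commute_raises hl₁ hm
  obtain ⟨Q₂, hLQ₂, hPQ₂⟩ := Steps.commute_raises hl₂ hm
  have hY₁ : Q₁.IsYoung :=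
    (Steps.inner_eq hPQ₁).1.trans ((isNormal_inwardSlide_iff P₁).1 h₁.2)
  have hY₂ : Q₂.IsYoung :=
    (Steps.inner_eq hPQ₂).1.trans ((isNormal_inwardSlide_iff P₂).1 h₂.2)
  obtain rfl := eq_of_reflTransGen_inwardSlide (reflTransGen_inwardSlide_iff.2 ⟨_, hLQ₁⟩)
    (reflTransGen_inwardSlide_iff.2 ⟨_, hLQ₂⟩) hY₁ (Steps.isLittlewoodRichardson hLQ₁ hL) hY₂
    (Steps.isLittlewoodRichardson hLQ₂ hL)
  exact Steps.injective Raises.injective hPQ₁ hPQ₂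

/-- The dual argument: one list of slides is transported to `L₁` and `L₂`. The ends coincide because
both keep the shape of `P`. -/
theorem normalForm_raisingStep_unique (T L₁ L₂ : SkewSSYT) (h₁ : IsNormalFormOf RaisingStep L₁ T)
    (h₂ : IsNormalFormOf RaisingStep L₂ T) : L₁ = L₂ := by
  obtain ⟨P, hTP, hP⟩ := exists_normalForm_inwardSlide T
  rw [isNormal_inwardSlide_iff] at hP
  obtain ⟨l, hl⟩ := reflTransGen_inwardSlide_iff.1 hTP
  obtain ⟨m₁, hm₁⟩ := reflTransGen_raisingStep_iff.1 h₁.1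
  obtain ⟨m₂, hm₂⟩ := reflTransGen_raisingStep_iff.1 h₂.1
  obtain ⟨Q₁, hLQ₁, hPQ₁⟩ := Steps.commute_raises hl hm₁
  obtain ⟨Q₂, hLQ₂, hPQ₂⟩ := Steps.commute_raises hl hm₂
  have e₁ := Steps.inner_eq hPQ₁
  have e₂ := Steps.inner_eq hPQ₂
  obtain rfl := eq_of_outer_eq (e₁.1.trans hP)
    (Steps.isLittlewoodRichardson hLQ₁ ((isNormal_raisingStep_iff L₁).1 h₁.2)) (e₂.1.trans hP)
    (Steps.isLittlewoodRichardson hLQ₂ ((isNormal_raisingStep_iff L₂).1 h₂.2))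
    fun r => by rw [e₁.2, e₂.2]
  exact Steps.injective LabelledSlide.injective hLQ₁ hLQ₂

/-- The slides from `T₁` to `P` are transported to `L`, then lifted back along the raisings from
`T₂`. They lead from `T₂` to a Young tableau, which must be `P` by uniqueness, so the same labelled
slides can be undone from `P` to both `T₁` and `T₂`. -/
theorem eq_of_normalForms {T₁ T₂ P L : SkewSSYT} (hP₁ : IsNormalFormOf InwardSlide P T₁)
    (hL₁ : IsNormalFormOf RaisingStep L T₁) (hP₂ : IsNormalFormOf InwardSlide P T₂)
    (hL₂ : IsNormalFormOf RaisingStep L T₂) : T₁ = T₂ := by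
  obtain ⟨l, hl⟩ := reflTransGen_inwardSlide_iff.1 hP₁.1
  obtain ⟨m₁, hm₁⟩ := reflTransGen_raisingStep_iff.1 hL₁.1
  obtain ⟨m₂, hm₂⟩ := reflTransGen_raisingStep_iff.1 hL₂.1
  obtain ⟨Q, hLQ, hPQ⟩ := Steps.commute_raises hl hm₁
  obtain ⟨P', hT₂P', hP'Q⟩ := Steps.lift_raises hm₂ hLQ
  have hY : P'.IsYoung := (Steps.inner_eq hP'Q).1.symm.trans
    ((Steps.inner_eq hPQ).1.trans ((isNormal_inwardSlide_iff P).1 hP₁.2))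
  obtain rfl := normalForm_inwardSlide_unique T₂ P P' hP₂
    ⟨reflTransGen_inwardSlide_iff.2 ⟨_, hT₂P'⟩, (isNormal_inwardSlide_iff P').2 hY⟩
  exact Steps.injective LabelledSlide.injective hl hT₂P'

end SkewSSYT

theorem mainTheorem3 :
    (Confluent SkewSSYT.InwardSlide ∧ Confluent SkewSSYT.RaisingStep) ∧
    (∀ T : SkewSSYT, IsNormal SkewSSYT.InwardSlide T ↔ T.IsYoung) ∧
    (∀ T : SkewSSYT, IsNormal SkewSSYT.RaisingStep T ↔ T.IsLittlewoodRichardson) ∧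
    (∀ T : SkewSSYT, ∃! P : SkewSSYT, IsNormalFormOf SkewSSYT.InwardSlide P T) ∧
    (∀ T : SkewSSYT, ∃! L : SkewSSYT, IsNormalFormOf SkewSSYT.RaisingStep L T) ∧
    (∀ T₁ T₂ P L : SkewSSYT,
      IsNormalFormOf SkewSSYT.InwardSlide P T₁ → IsNormalFormOf SkewSSYT.RaisingStep L T₁ →
      IsNormalFormOf SkewSSYT.InwardSlide P T₂ → IsNormalFormOf SkewSSYT.RaisingStep L T₂ →
      T₁ = T₂) := by
  refine ⟨⟨?_, ?_⟩, SkewSSYT.isNormal_inwardSlide_iff, SkewSSYT.isNormal_raisingStep_iff, ?_, ?_, ?_⟩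
  · exact confluent_of_normalForm SkewSSYT.exists_normalForm_inwardSlide
      SkewSSYT.normalForm_inwardSlide_unique
  · exact confluent_of_normalForm SkewSSYT.exists_normalForm_raisingStep
      SkewSSYT.normalForm_raisingStep_unique
  · intro T
    obtain ⟨P, hP⟩ := SkewSSYT.exists_normalForm_inwardSlide T
    exact ⟨P, hP, fun P' hP' => SkewSSYT.normalForm_inwardSlide_unique T P' P hP' hP⟩
  · intro T
    obtain ⟨L, hL⟩ := SkewSSYT.exists_normalForm_raisingStep T
    exact ⟨L, hL, fun L' hL' => SkewSSYT.normalForm_raisingStep_unique T L' L hL' hL⟩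
  · exact fun T₁ T₂ P L => SkewSSYT.eq_of_normalForms
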